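/- **Setting.** Let $n\ge 1$, let $t_i,s_j\in\mathbb C$ $(1\le i,j\le n)$ with $t_i\ne s_j$ for all $i,j$, let $\Phi\in\mathbb C^{n\times 2}$, $\Psi\in\mathbb C^{2\times n}$, and let $R$ be the Cauchy-type matrix with $D_tR-RD_s=\Phi\Psi$, i.e. $r_{ij}=\varphi_i\psi_j/(t_i-s_j)$, where $D_t=\mathrm{diag}(t_i)$, $D_s=\mathrm{diag}(s_j)$, $\varphi_i$ is the $i$-th row of $\Phi$ and $\psi_j$ the $j$-th column of $\Psi$. The GKO-Cauchy algorithm with partial pivoting computes, starting from $\Phi^{(1)}=\Phi$, $\Psi^{(1)}=\Psi$, at step $k=1,\dots,n$: $r^{(k)}_{ik}=\varphi^{(k)}_i\psi^{(k)}_k/(t_i-s_k)$ for $i\ge k$; a row interchange that brings an entry of largest modulus of this column to the pivot position $k$; then $u_{kj}=\varphi^{(k)}_k\psi^{(k)}_j/(t_k-s_j)$ for $j\ge k$, $l_{kk}=1$, and for $i,j>k$: $l_{ik}=r^{(k)}_{ik}/u_{kk}$, $\varphi^{(k+1)}_i=\varphi^{(k)}_i-\varphi^{(k)}_kl_{ik}$,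 $\psi^{(k+1)}_j=\psi^{(k)}_j-\psi^{(k)}_ku_{kj}/u_{kk}$; the other rows of $\Phi^{(k+1)}$ and columns of $\Psi^{(k+1)}$ are zero. All operations are carried out in floating-point arithmetic with $fl(a\star b)=(a\star b)(1+\delta)$, $|\delta|\le\epsilon$, for the four basic operations on $\mathbb C$; the $t_i,s_j$ and $\Phi,\Psi$ are the exact input, and no pivot $u_{kk}$ with $k<n$ vanishes. Let $L,U$ be the computed factors and let $\Phi^{(k)},\Psi^{(k)}$ be the computed generators. Rows are taken in the final pivot order, so that $R$ stands for the row-permuted matrix. Let $E=LU-R$, let $B=[1/(t_i-s_j)]$, and let $b_{\max}$, $b_{\min}$ be the maximum and minimum moduli of the entries of $B$. $\|\cdot\|$ is the Frobenius norm. Let $V^{(k)}=[v^{(k)}_{ij}]$ be given by $|\Phi^{(k)}||\Psi^{(k)}|=V^{(k)}\circ\Phi^{(k)}\Psi^{(k)}$ (entrywise moduli and entrywise product), and assume that all $V^{(k)}$ exist (entries with $0=v\cdot 0$ are set to $v=0$). Put $\hat L=[v^{(k)}_{ik}l_{ik}]_{i,k}$, $\hat U=[u_{kj}v^{(k)}_{kj}]_{k,j}$,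 $R_k=L_{:,k:n}U_{k:n,:}$, $\hat R_k=V^{(k)}\circ R_k$ and $$g_1=c_7\frac{\|\hat L\|}{\|L\|}+c_8\frac{\|\hat U\|}{\|U\|}+c_9\|\mathrm{diag}(v^{(k)}_{kk})\|,\qquad g_2=\max_{2\le k\le n}\frac{\|\hat R_k\|}{\|R_k\|},\qquad g_3=\max(g_1,g_2),$$ with $g_2=0$ if $n=1$ and $0/0=0$. Now let $T=[a_{i-j}]\in\mathbb C^{n\times n}$ be a Toeplitz matrix and $R=FTD^{-1}F^*$, where $F=\frac1{\sqrt n}[e^{2\pi i(k-1)(j-1)/n}]_{k,j}$ and $D=\mathrm{diag}(1,e^{\pi i/n},\dots,e^{\pi i(n-1)/n})$. **Claim.** (1) $R$ is of Cauchy type with nodes $t_k=e^{2\pi i(k-1)/n}$, $s_k=e^{\pi i(2k-1)/n}$ and generator $\Phi=F\Omega$, $\Psi^*=FD\Gamma^*$, where $\Omega^T=\begin{bmatrix}1&0&\cdots&0\\a_0&a_{1-n}+a_1&\cdots&a_{-1}+a_{n-1}\end{bmatrix}$ and $\Gamma=\begin{bmatrix}a_{n-1}-a_{-1}&\cdots&a_1-a_{1-n}&a_0\\0&\cdots&0&1\end{bmatrix}$.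 The $t_k$ are the $n$ distinct roots of $z^n=1$, the $s_k$ are the $n$ distinct roots of $z^n=-1$, and they interlace on the unit circle: $s_k=e^{\pi i/n}t_k$ and $t_{k+1}=e^{\pi i/n}s_k$ (cyclically in $k$). (2) $b_{\max}/b_{\min}<2n/\pi$ if $n$ is even, $b_{\max}/b_{\min}=1/\sin(\pi/(2n))$ if $n$ is odd, and $b_{\max}/b_{\min}\le n$ in all cases. (3) There are absolute constants $c_5,c_6>0$, $c_7,c_8,c_9\in(0,1)$ and $\eta>0$ such that, whenever $\epsilon\le\eta$ and $n\epsilon|v^{(k)}_{ij}|\le\eta$ for all $i,j,k$, every Cauchy-type $R$ as above satisfies $$\|E\|\le\epsilon\Bigl(c_5\frac{b_{\max}}{b_{\min}}g_1+c_6ng_2\Bigr)\|L\|\|U\|,$$ and every $R=FTD^{-1}F^*$ that comes from a Toeplitz matrix, with the nodes and the generator in (1), satisfies, with the same constants, $$\|E\|\le\epsilon\,c_{10}\,g_3\,n\,\|L\|\|U\|,\qquad c_{10}=\max(2c_5/\pi,c_6).$$ -/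

import Mathlib

open scoped Matrix

attribute [local instance] Matrix.frobeniusNormedAddCommGroup

namespace GKO

/-- The standard model of floating-point arithmetic with machine epsilon `ε` (no overflow or
underflow): every basic operation returns the exact result up to a relative error of modulus at
most `ε`. -/
structure FloatArith (ε : ℝ) where
  add : ℂ → ℂ → ℂ
  sub : ℂ → ℂ → ℂ
  mul : ℂ → ℂ → ℂ
  div : ℂ → ℂ → ℂ
  add_spec : ∀ a b : ℂ, ∃ δ : ℂ, ‖δ‖ ≤ ε ∧ add a b = (a + b) * (1 + δ)
  sub_spec : ∀ a b : ℂ, ∃ δ : ℂ, ‖δ‖ ≤ ε ∧ sub a b = (a - b) * (1 + δ)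
  mul_spec : ∀ a b : ℂ, ∃ δ : ℂ, ‖δ‖ ≤ ε ∧ mul a b = (a * b) * (1 + δ)
  div_spec : ∀ a b : ℂ, b ≠ 0 → ∃ δ : ℂ, ‖δ‖ ≤ ε ∧ div a b = (a / b) * (1 + δ)

/-- The input of the GKO-Cauchy algorithm: nodes `t`, `s` and a generator `Φ`, `Ψ` of
displacement rank (at most) two. -/
structure CauchyData (n : ℕ) where
  t : Fin n → ℂ
  s : Fin n → ℂ
  Φ : Matrix (Fin n) (Fin 2) ℂ
  Ψ : Matrix (Fin 2) (Fin n) ℂ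

namespace CauchyData

variable {n : ℕ}

/-- `R` is the Cauchy-type matrix given by the data: no `t i` equals an `s j`, and `R` satisfies
the displacement equation `D_t R - R D_s = Φ Ψ`. -/
def Generates (C : CauchyData n) (R : Matrix (Fin n) (Fin n) ℂ) : Prop :=
  (∀ i j, C.t i ≠ C.s j) ∧
    Matrix.diagonal C.t * R - R * Matrix.diagonal C.s = C.Φ * C.Ψ

/-- Reordering of the rows of the matrix (hence of the `t i` and of the rows of `Φ`). -/
def permRows (C : CauchyData n) (σ : Equiv.Perm (Fin n)) : CauchyData n where
  t := C.t ∘ σ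
  s := C.s
  Φ := C.Φ.submatrix σ id
  Ψ := C.Ψ

/-- The ordinary Cauchy matrix `[1 / (t i - s j)]`. -/
noncomputable def B (C : CauchyData n) : Matrix (Fin n) (Fin n) ℂ :=
  Matrix.of fun i j => 1 / (C.t i - C.s j)

/-- The maximum modulus of the entries of `B`. -/
noncomputable def bMax (C : CauchyData n) : ℝ := ⨆ p : Fin n × Fin n, ‖C.B p.1 p.2‖

/-- The minimum modulus of the entries of `B`. -/
noncomputable def bMin (C : CauchyData n) : ℝ := ⨅ p : Fin n × Fin n, ‖C.B p.1 p.2‖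

end CauchyData

section Algorithm

variable {n : ℕ} {ε : ℝ}

/-- The computed entry `φ_i ψ_j / (t_i - s_j)` for the generator `g = (Φ, Ψ)`. -/
def flEntry (fl : FloatArith ε) (C : CauchyData n)
    (g : Matrix (Fin n) (Fin 2) ℂ × Matrix (Fin 2) (Fin n) ℂ) (i j : Fin n) : ℂ :=
  fl.div (fl.add (fl.mul (g.1 i 0) (g.2 0 j)) (fl.mul (g.1 i 1) (g.2 1 j)))
    (fl.sub (C.t i) (C.s j))

/-- The computed multiplier `l_ik` of step `k`, for `i > k`. -/
def flMult (fl : FloatArith ε) (C : CauchyData n)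
    (g : Matrix (Fin n) (Fin 2) ℂ × Matrix (Fin 2) (Fin n) ℂ) (i k : Fin n) : ℂ :=
  fl.div (flEntry fl C g i k) (flEntry fl C g k k)

/-- The generator update of step `k`: `φ_i ← φ_i - φ_k l_ik` for `i > k` and
`ψ_j ← ψ_j - ψ_k u_kj / u_kk` for `j > k`; the other rows and columns become zero. -/
def flStep (fl : FloatArith ε) (C : CauchyData n) (k : Fin n)
    (g : Matrix (Fin n) (Fin 2) ℂ × Matrix (Fin 2) (Fin n) ℂ) :
    Matrix (Fin n) (Fin 2) ℂ × Matrix (Fin 2) (Fin n) ℂ :=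
  (Matrix.of fun i a =>
      if k < i then fl.sub (g.1 i a) (fl.mul (g.1 k a) (flMult fl C g i k)) else 0,
   Matrix.of fun a j =>
      if k < j then
        fl.sub (g.2 a j) (fl.div (fl.mul (g.2 a k) (flEntry fl C g k j)) (flEntry fl C g k k))
      else 0)

/-- The computed generators at the beginning of step `k` (steps are numbered from `0`), for rows
that are already in the order in which they are eliminated. -/
def gens (fl : FloatArith ε) (C : CauchyData n) :
    ℕ → Matrix (Fin n) (Fin 2) ℂ × Matrix (Fin 2) (Fin n) ℂ
  | 0 => (C.Φ, C.Ψ)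
  | k + 1 => if h : k < n then flStep fl C ⟨k, h⟩ (gens fl C k) else 0

/-- The computed entry `r_ij^{(k)}` of the reduced matrix at step `k`. -/
def compR (fl : FloatArith ε) (C : CauchyData n) (k i j : Fin n) : ℂ :=
  flEntry fl C (gens fl C k) i j

/-- The computed lower triangular factor. -/
def compL (fl : FloatArith ε) (C : CauchyData n) : Matrix (Fin n) (Fin n) ℂ :=
  Matrix.of fun i k =>
    if k < i then flMult fl C (gens fl C k) i k else if i = k then 1 else 0

/-- The computed upper triangular factor. -/
def compU (fl : FloatArith ε) (C : CauchyData n) : Matrix (Fin n) (Fin n) ℂ :=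
  Matrix.of fun k j => if k ≤ j then compR fl C k k j else 0

/-- The elimination uses partial pivoting and does not divide by zero. A run with row interchanges
whose total effect is a permutation is the run without interchanges on the rows reordered by that
permutation, in which the pivot of each step is an entry of largest computed modulus of its
column; this condition is stated for the reordered data. -/
structure Pivoted (fl : FloatArith ε) (C : CauchyData n) : Prop where
  le_pivot : ∀ k i : Fin n, k ≤ i → ‖compR fl C k i k‖ ≤ ‖compR fl C k k k‖
  pivot_ne : ∀ k : Fin n, (k : ℕ) + 1 < n → compR fl C k k k ≠ 0

/-- The entry `(|Φ| |Ψ|)_ij` for the computed generators at step `k`. -/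
noncomputable def absProd (fl : FloatArith ε) (C : CauchyData n) (k i j : Fin n) : ℝ :=
  ∑ a : Fin 2, ‖(gens fl C k).1 i a‖ * ‖(gens fl C k).2 a j‖

/-- The matrix `V^{(k)}`, the entrywise quotient of `|Φ| |Ψ|` by `Φ Ψ`. -/
noncomputable def V (fl : FloatArith ε) (C : CauchyData n) (k : Fin n) :
    Matrix (Fin n) (Fin n) ℂ :=
  Matrix.of fun i j => (absProd fl C k i j : ℂ) / ((gens fl C k).1 * (gens fl C k).2) i j

/-- All the `V^{(k)}` exist: `|Φ| |Ψ| = V^{(k)} ∘ Φ Ψ` at every step, that is, no entry of `Φ Ψ`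
vanishes through cancellation. -/
def VDefined (fl : FloatArith ε) (C : CauchyData n) : Prop :=
  ∀ k i j : Fin n,
    (absProd fl C k i j : ℂ) = V fl C k i j * ((gens fl C k).1 * (gens fl C k).2) i j

/-- The matrix `L̂`, whose column `k` is column `k` of `V^{(k)}` times that of `L`, entrywise. -/
noncomputable def hatL (fl : FloatArith ε) (C : CauchyData n) : Matrix (Fin n) (Fin n) ℂ :=
  Matrix.of fun i k => V fl C k i k * compL fl C i k

/-- The matrix `Û`, whose row `k` is row `k` of `V^{(k)}` times that of `U`, entrywise. -/
noncomputable def hatU (fl : FloatArith ε) (C : CauchyData n) : Matrix (Fin n) (Fin n) ℂ :=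
  Matrix.of fun k j => compU fl C k j * V fl C k k j

/-- The matrix `R_k = L_{:,k:n} U_{k:n,:}`. -/
def trailing (fl : FloatArith ε) (C : CauchyData n) (k : Fin n) : Matrix (Fin n) (Fin n) ℂ :=
  Matrix.of fun i j => ∑ m ∈ Finset.Ici k, compL fl C i m * compU fl C m j

/-- The matrix `R̂_k = V^{(k)} ∘ L_{:,k:n} U_{k:n,:}`. -/
noncomputable def hatR (fl : FloatArith ε) (C : CauchyData n) (k : Fin n) :
    Matrix (Fin n) (Fin n) ℂ :=
  Matrix.of fun i j => V fl C k i j * trailing fl C k i j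

/-- The generator growth factor `g₁` (Frobenius norms). -/
noncomputable def g₁ (c₇ c₈ c₉ : ℝ) (fl : FloatArith ε) (C : CauchyData n) : ℝ :=
  c₇ * (‖hatL fl C‖ / ‖compL fl C‖) + c₈ * (‖hatU fl C‖ / ‖compU fl C‖)
    + c₉ * ‖(Matrix.diagonal fun k => V fl C k k k : Matrix (Fin n) (Fin n) ℂ)‖

/-- The generator growth factor `g₂`, a maximum over all steps but the first (zero if there are
none). -/
noncomputable def g₂ (fl : FloatArith ε) (C : CauchyData n) : ℝ :=
  ⨆ k : {k : Fin n // 0 < (k : ℕ)}, ‖hatR fl C k‖ / ‖trailing fl C k‖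

/-- The backward error `E = L U - R` for the computed factors. -/
def backwardError (fl : FloatArith ε) (C : CauchyData n) (R : Matrix (Fin n) (Fin n) ℂ) :
    Matrix (Fin n) (Fin n) ℂ :=
  compL fl C * compU fl C - R

end Algorithm

section Toeplitz

/-- The Toeplitz matrix `[a_{i-j}]`. -/
def toeplitz (n : ℕ) (a : ℤ → ℂ) : Matrix (Fin n) (Fin n) ℂ :=
  Matrix.of fun i j => a ((i : ℤ) - (j : ℤ))

/-- The discrete Fourier transform matrix. -/
noncomputable def dft (n : ℕ) : Matrix (Fin n) (Fin n) ℂ :=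
  Matrix.of fun k j =>
    (1 / (Real.sqrt n : ℂ)) * Complex.exp (2 * Real.pi * Complex.I * (k : ℕ) * (j : ℕ) / n)

/-- The matrix `D = diag(1, e^{πi/n}, …, e^{πi(n-1)/n})`. -/
noncomputable def matD (n : ℕ) : Matrix (Fin n) (Fin n) ℂ :=
  Matrix.diagonal fun k => Complex.exp (Real.pi * Complex.I * (k : ℕ) / n)

/-- The matrix `R = F T D⁻¹ F*`. -/
noncomputable def toeplitzR (n : ℕ) (a : ℤ → ℂ) : Matrix (Fin n) (Fin n) ℂ :=
  dft n * toeplitz n a * (matD n)⁻¹ * (dft n)ᴴ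

/-- The left `{Z₁, Z₋₁}`-generator of the Toeplitz matrix: the first column is `e₁`, the second
one is `(a_0, a_{1-n} + a_1, …, a_{-1} + a_{n-1})`. -/
noncomputable def toeplitzΩ (n : ℕ) (a : ℤ → ℂ) : Matrix (Fin n) (Fin 2) ℂ :=
  Matrix.of fun i =>
    if (i : ℕ) = 0 then ![1, a 0] else ![0, a ((i : ℤ) - n) + a (i : ℤ)]

/-- The right `{Z₁, Z₋₁}`-generator of the Toeplitz matrix: the first row is
`(a_{n-1} - a_{-1}, …, a_1 - a_{1-n}, a_0)`, the second one is the last unit vector. -/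
noncomputable def toeplitzΓ (n : ℕ) (a : ℤ → ℂ) : Matrix (Fin 2) (Fin n) ℂ :=
  Matrix.of fun r j =>
    if (j : ℕ) + 1 = n then ![a 0, 1] r
    else ![a ((n : ℤ) - 1 - (j : ℤ)) - a (-1 - (j : ℤ)), 0] r

/-- The Cauchy data of `R = F T D⁻¹ F*`: nodes `t_k = e^{2πik/n}`, `s_k = e^{πi(2k+1)/n}` for
`0 ≤ k < n`, and the generator `Φ = F Ω`, `Ψ* = F D Γ*`. -/
noncomputable def toeplitzData (n : ℕ) (a : ℤ → ℂ) : CauchyData n where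
  t k := Complex.exp (2 * Real.pi * Complex.I * (k : ℕ) / n)
  s k := Complex.exp (Real.pi * Complex.I * (2 * (k : ℕ) + 1) / n)
  Φ := dft n * toeplitzΩ n a
  Ψ := (dft n * matD n * (toeplitzΓ n a)ᴴ)ᴴ

end Toeplitz

end GKO

/-!
The proof measures every error after the displacement `X ↦ D_t X - X D_s`, which multiplies the
entry `x_ij` by `t_i - s_j`. The exact product `l_k u_k` of a column of `L` and a row of `U` has
displacement `Φ^{(k)} Ψ^{(k)} - Φ^{(k+1)} Ψ^{(k+1)}` in exact arithmetic; with rounding, the defect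
of this identity is `residual`. The displacement of `R` is `Φ^{(0)} Ψ^{(0)}` and the last generator
is zero, so the residuals telescope: their sum is the displacement of `L U - R`
(`sub_mul_backwardError`), and the later ones sum to the displacement of `R_k` minus
`Φ^{(k)} Ψ^{(k)}` (`sub_mul_trailing`).

A residual consists of the errors of the computed entries in the pivot row and column, and of the
errors of the generator update (`Admissible.norm_residual_le`). The former are `O(ε)` times
`|Φ^{(k)}| |Ψ^{(k)}|` in the pivot row and column, which `V^{(k)}` turns into multiples of the
computed `l_ik` and `u_kj` (`Admissible.absMul_le`). The latter contain in addition
`ε |Φ^{(k+1)}| |Ψ^{(k+1)}|` at the position `(i, j)` itself. This is `ε |V^{(k+1)}|` times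
the modulus of `Φ^{(k+1)} Ψ^{(k+1)}`, hence at most the corresponding multiple of the displacement
of `R_{k+1}` plus `ε |V^{(k+1)}|` times the sum of the residuals. As `n ε |v|` is small, the sum of
all residuals at one position absorbs the latter terms (`Admissible.sum_norm_residual_le`).
Dividing by `t_i - s_j` costs a factor `b_max / b_min` in the terms that carry a different node
difference, and none in the terms with `R_k`. The triangle inequality and submultiplicativity of
the Frobenius norm give the bound. The choice of the pivots enters only through the nonvanishing
of the divisors.

For Toeplitz matrices, `F` diagonalizes the circulant shift `Z_1`, `F D` diagonalizes the
skew-circulant shift `Z_{-1}`, and `Z_1 T - T Z_{-1} = Ω Γ` by inspection of the entries. The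
distances `|t_i - s_j|` are the chords `2 sin (π m / (2 n))` with `m ≤ n` odd; `m = 1` gives the
smallest one, and the largest has `m = n` if `n` is odd and `m ≤ n - 1` if `n` is even.
-/

/-! ### Rounding errors of single operations and of the generator update -/

namespace GKO

section Rounding

variable {n : ℕ} {ε : ℝ}

lemma FloatArith.eps_nonneg (fl : FloatArith ε) : 0 ≤ ε := by
  obtain ⟨δ, h, -⟩ := fl.add_spec 0 0
  exact (norm_nonneg δ).trans h

lemma one_add_ne_zero_of_norm_le (hε : ε ≤ 1 / 1000) {δ : ℂ} (hδ : ‖δ‖ ≤ ε) : 1 + δ ≠ 0 := by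
  intro h
  have : ‖δ‖ = 1 := by rw [← neg_eq_of_add_eq_zero_right h, norm_neg, norm_one]
  linarith

lemma le_norm_one_add (hε : ε ≤ 1 / 1000) {δ : ℂ} (hδ : ‖δ‖ ≤ ε) : 999 / 1000 ≤ ‖1 + δ‖ := by
  have := norm_sub_norm_le (1 : ℂ) (-δ)
  rw [norm_neg, norm_one, sub_neg_eq_add] at this
  linarith

lemma norm_mul_le_mul_norm {δ : ℂ} (hδ : ‖δ‖ ≤ ε) (a : ℂ) : ‖a * δ‖ ≤ ε * ‖a‖ := by
  rw [norm_mul, mul_comm]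
  gcongr

lemma norm_quotient_sub_one_le (hε : ε ≤ 1 / 1000) {δ₁ δ₂ δ₃ : ℂ}
    (h₁ : ‖δ₁‖ ≤ ε) (h₂ : ‖δ₂‖ ≤ ε) (h₃ : ‖δ₃‖ ≤ ε) :
    ‖(1 + δ₁) * (1 + δ₂) / (1 + δ₃) - 1‖ ≤ 7 / 2 * ε := by
  have h0 := one_add_ne_zero_of_norm_le hε h₃
  have hge := le_norm_one_add hε h₃
  have he : 0 ≤ ε := (norm_nonneg _).trans h₁
  rw [show (1 + δ₁) * (1 + δ₂) / (1 + δ₃) - 1 = (δ₁ + δ₂ + δ₁ * δ₂ - δ₃) / (1 + δ₃) by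
    field_simp; ring, norm_div, div_le_iff₀ (by linarith)]
  have h12 : ‖δ₁ * δ₂‖ ≤ ε * ε := by rw [norm_mul]; gcongr
  have hs : ‖δ₁ + δ₂ + δ₁ * δ₂ - δ₃‖ ≤ ‖δ₁‖ + ‖δ₂‖ + ‖δ₁ * δ₂‖ + ‖δ₃‖ :=
    (norm_sub_le _ _).trans (by gcongr; exact norm_add₃_le)
  nlinarith

/-- The entry `(|Φ| |Ψ|)_ij` for the generator `g = (Φ, Ψ)`. -/
noncomputable def absMul (g : Matrix (Fin n) (Fin 2) ℂ × Matrix (Fin 2) (Fin n) ℂ)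
    (i j : Fin n) : ℝ :=
  ∑ a : Fin 2, ‖g.1 i a‖ * ‖g.2 a j‖

lemma absMul_nonneg (g : Matrix (Fin n) (Fin 2) ℂ × Matrix (Fin 2) (Fin n) ℂ) (i j : Fin n) :
    0 ≤ absMul g i j :=
  Finset.sum_nonneg fun _ _ => by positivity

lemma norm_mul_apply_le_absMul (g : Matrix (Fin n) (Fin 2) ℂ × Matrix (Fin 2) (Fin n) ℂ)
    (i j : Fin n) : ‖(g.1 * g.2) i j‖ ≤ absMul g i j := by
  rw [Matrix.mul_apply]
  exact (norm_sum_le _ _).trans_eq (by simp [absMul])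

/-- The five roundings in a computed entry: two products, their sum, the difference of the nodes
and the quotient. -/
lemma norm_flEntry_sub_le (hε : ε ≤ 1 / 1000) (fl : FloatArith ε) (C : CauchyData n)
    (g : Matrix (Fin n) (Fin 2) ℂ × Matrix (Fin 2) (Fin n) ℂ) (i j : Fin n)
    (hts : C.t i ≠ C.s j) :
    ‖(C.t i - C.s j) * flEntry fl C g i j - (g.1 * g.2) i j‖ ≤ 5 * ε * absMul g i j := by
  have he := fl.eps_nonneg
  have hd : C.t i - C.s j ≠ 0 := sub_ne_zero.mpr hts
  obtain ⟨δ₁, h₁, e₁⟩ := fl.mul_spec (g.1 i 0) (g.2 0 j)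
  obtain ⟨δ₂, h₂, e₂⟩ := fl.mul_spec (g.1 i 1) (g.2 1 j)
  obtain ⟨δ₃, h₃, e₃⟩ := fl.add_spec (fl.mul (g.1 i 0) (g.2 0 j)) (fl.mul (g.1 i 1) (g.2 1 j))
  obtain ⟨δ₄, h₄, e₄⟩ := fl.sub_spec (C.t i) (C.s j)
  have h4 := one_add_ne_zero_of_norm_le hε h₄
  obtain ⟨δ₅, h₅, e₅⟩ := fl.div_spec
    (fl.add (fl.mul (g.1 i 0) (g.2 0 j)) (fl.mul (g.1 i 1) (g.2 1 j)))
    (fl.sub (C.t i) (C.s j)) (by rw [e₄]; exact mul_ne_zero hd h4)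
  have hκ := norm_quotient_sub_one_le hε h₃ h₅ h₄
  set κ := (1 + δ₃) * (1 + δ₅) / (1 + δ₄) with hκd
  set x := g.1 i 0 * g.2 0 j with hx
  set y := g.1 i 1 * g.2 1 j with hy
  have hw : absMul g i j = ‖x‖ + ‖y‖ := by simp [absMul, hx, hy]
  have hp : (g.1 * g.2) i j = x + y := by simp [Matrix.mul_apply, hx, hy]
  have key : (C.t i - C.s j) * flEntry fl C g i j - (g.1 * g.2) i j
      = (x + y) * (κ - 1) + (x * δ₁ + y * δ₂) * ((κ - 1) + 1) := by
    rw [hp, flEntry, e₅, e₃, e₄, e₁, e₂, hκd]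
    field_simp
    ring
  rw [key, hw]
  have hsum : ‖x * δ₁ + y * δ₂‖ ≤ ε * (‖x‖ + ‖y‖) := by
    have := norm_add_le (x * δ₁) (y * δ₂)
    have := norm_mul_le_mul_norm h₁ x
    have := norm_mul_le_mul_norm h₂ y
    linarith
  have hxy := norm_add_le x y
  have hκ1 : ‖κ - 1 + 1‖ ≤ 7 / 2 * ε + 1 := by
    have := norm_add_le (κ - 1) 1
    rw [norm_one] at this
    linarith
  calc _ ≤ ‖x + y‖ * ‖κ - 1‖ + ‖x * δ₁ + y * δ₂‖ * ‖κ - 1 + 1‖ := by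
        rw [← norm_mul, ← norm_mul]; exact norm_add_le _ _
    _ ≤ (‖x‖ + ‖y‖) * (7 / 2 * ε) + (ε * (‖x‖ + ‖y‖)) * (7 / 2 * ε + 1) := by gcongr
    _ = (9 / 2 * ε + 7 / 2 * ε * ε) * (‖x‖ + ‖y‖) := by ring
    _ ≤ _ := by gcongr; nlinarith

/-- The rounding error of a subtraction `a - c'` whose second operand is itself inexact, bounded
in terms of the computed difference. -/
lemma norm_fl_sub_sub_le (hε : ε ≤ 1 / 1000) (fl : FloatArith ε) (a c c' : ℂ) :
    ‖fl.sub a c' - (a - c)‖ ≤ 2 * ε * ‖fl.sub a c'‖ + ‖c' - c‖ := by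
  have he := fl.eps_nonneg
  obtain ⟨δ, h, e⟩ := fl.sub_spec a c'
  have hge := le_norm_one_add hε h
  have hn : ‖(a - c') * δ‖ ≤ 2 * ε * ‖fl.sub a c'‖ := by
    rw [e, norm_mul, norm_mul]
    calc ‖a - c'‖ * ‖δ‖ ≤ ‖a - c'‖ * ε := by gcongr
      _ = 2 * ε * (‖a - c'‖ * (1 / 2)) := by ring
      _ ≤ _ := by gcongr; linarith
  rw [show fl.sub a c' - (a - c) = (a - c') * δ - (c' - c) by rw [e]; ring]
  exact (norm_sub_le _ _).trans (by gcongr)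

lemma norm_left_update_sub_le (hε : ε ≤ 1 / 1000) (fl : FloatArith ε) (a b l : ℂ) :
    ‖fl.sub a (fl.mul b l) - (a - b * l)‖
      ≤ 2 * ε * ‖fl.sub a (fl.mul b l)‖ + 3 * ε * ‖b * l‖ := by
  have he := fl.eps_nonneg
  refine (norm_fl_sub_sub_le hε fl a (b * l) _).trans ?_
  obtain ⟨δ, h, e⟩ := fl.mul_spec b l
  rw [show fl.mul b l - b * l = b * l * δ by rw [e]; ring]
  gcongr
  refine (norm_mul_le_mul_norm h _).trans ?_
  gcongr
  linarith

lemma norm_right_update_sub_le (hε : ε ≤ 1 / 1000) (fl : FloatArith ε) (a b u p : ℂ)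
    (hp : p ≠ 0) :
    ‖fl.sub a (fl.div (fl.mul b u) p) - (a - b * (u / p))‖
      ≤ 2 * ε * ‖fl.sub a (fl.div (fl.mul b u) p)‖ + 3 * ε * ‖b * (u / p)‖ := by
  have he := fl.eps_nonneg
  refine (norm_fl_sub_sub_le hε fl a (b * (u / p)) _).trans ?_
  obtain ⟨δ₁, h₁, e₁⟩ := fl.mul_spec b u
  obtain ⟨δ₂, h₂, e₂⟩ := fl.div_spec (fl.mul b u) p hp
  rw [show fl.div (fl.mul b u) p - b * (u / p) = b * (u / p) * (δ₁ + δ₂ + δ₁ * δ₂) by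
    rw [e₂, e₁]; ring]
  gcongr
  refine norm_mul_le_mul_norm ?_ _
  have : ‖δ₁ * δ₂‖ ≤ ε * ε := by rw [norm_mul]; gcongr
  refine norm_add₃_le.trans ?_
  nlinarith

/-- Effect of the update errors on one summand of `φ_i ψ_j`: `X`, `Y` are the computed updates of
`a - b l` and `c - d q`. -/
lemma norm_update_mul_sub_le (hε : ε ≤ 1 / 1000) (he : 0 ≤ ε) {X Y a b c d l q : ℂ}
    (hX : ‖X - (a - b * l)‖ ≤ 2 * ε * ‖X‖ + 3 * ε * ‖b * l‖)
    (hY : ‖Y - (c - d * q)‖ ≤ 2 * ε * ‖Y‖ + 3 * ε * ‖d * q‖) :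
    ‖X * Y - (a - b * l) * (c - d * q)‖ ≤ ε * (5 * (‖X‖ * ‖Y‖)
      + 13 * (‖q‖ * (‖a‖ * ‖d‖) + ‖l‖ * (‖b‖ * ‖c‖) + ‖l‖ * ‖q‖ * (‖b‖ * ‖d‖))) := by
  have hX2 : ‖X‖ ≤ 2 * (‖a‖ + ‖b * l‖) := by
    have h1 := norm_sub_norm_le X (a - b * l)
    have h2 := norm_sub_le a (b * l)
    have := mul_le_mul_of_nonneg_right hε (norm_nonneg X)
    have := mul_le_mul_of_nonneg_right hε (norm_nonneg (b * l))
    linarith [norm_nonneg a, norm_nonneg (b * l)]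
  have hY2 : ‖Y‖ ≤ 2 * (‖c‖ + ‖d * q‖) := by
    have h1 := norm_sub_norm_le Y (c - d * q)
    have h2 := norm_sub_le c (d * q)
    have := mul_le_mul_of_nonneg_right hε (norm_nonneg Y)
    have := mul_le_mul_of_nonneg_right hε (norm_nonneg (d * q))
    linarith [norm_nonneg c, norm_nonneg (d * q)]
  have hsplit : ‖X * Y - (a - b * l) * (c - d * q)‖
      ≤ ‖X - (a - b * l)‖ * ‖Y‖ + ‖X‖ * ‖Y - (c - d * q)‖
        + ‖X - (a - b * l)‖ * ‖Y - (c - d * q)‖ := by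
    rw [← norm_mul, ← norm_mul, ← norm_mul]
    rw [show X * Y - (a - b * l) * (c - d * q) = (X - (a - b * l)) * Y + X * (Y - (c - d * q))
      - (X - (a - b * l)) * (Y - (c - d * q)) by ring]
    exact (norm_sub_le _ _).trans (by gcongr; exact norm_add_le _ _)
  rw [show ‖q‖ * (‖a‖ * ‖d‖) = ‖a‖ * ‖d * q‖ by rw [norm_mul]; ring,
    show ‖l‖ * (‖b‖ * ‖c‖) = ‖b * l‖ * ‖c‖ by rw [norm_mul]; ring,
    show ‖l‖ * ‖q‖ * (‖b‖ * ‖d‖) = ‖b * l‖ * ‖d * q‖ by rw [norm_mul, norm_mul]; ring]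
  have hD := norm_nonneg (Y - (c - d * q))
  generalize ‖X - (a - b * l)‖ = D₁ at *
  generalize ‖Y - (c - d * q)‖ = D₂ at *
  have hβ := norm_nonneg (b * l)
  have hτ := norm_nonneg (d * q)
  generalize ‖b * l‖ = β at *
  generalize ‖d * q‖ = τ at *
  have hξ := norm_nonneg X
  have hυ := norm_nonneg Y
  have hα := norm_nonneg a
  have hγ := norm_nonneg c
  generalize ‖X‖ = ξ at *
  generalize ‖Y‖ = υ at *
  generalize ‖a‖ = α at *
  generalize ‖c‖ = γ at *
  have hβυ : β * υ ≤ 2 * (β * γ + β * τ) := by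
    nlinarith [mul_le_mul_of_nonneg_left hY2 hβ]
  have hξτ : ξ * τ ≤ 2 * (α * τ + β * τ) := by
    nlinarith [mul_le_mul_of_nonneg_right hX2 hτ]
  have hee : ε * ε ≤ ε * (1 / 1000) := by gcongr
  have hS : 0 ≤ 4 * (ξ * υ) + 6 * (ξ * τ) + 6 * (β * υ) + 9 * (β * τ) := by positivity
  calc _ ≤ _ := hsplit
    _ ≤ (2 * ε * ξ + 3 * ε * β) * υ + ξ * (2 * ε * υ + 3 * ε * τ)
        + (2 * ε * ξ + 3 * ε * β) * (2 * ε * υ + 3 * ε * τ) := by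
      have : 0 ≤ 2 * ε * ξ + 3 * ε * β := by positivity
      gcongr
    _ = ε * (4 * (ξ * υ) + 3 * (β * υ) + 3 * (ξ * τ))
        + ε * ε * (4 * (ξ * υ) + 6 * (ξ * τ) + 6 * (β * υ) + 9 * (β * τ)) := by ring
    _ ≤ ε * (4 * (ξ * υ) + 3 * (β * υ) + 3 * (ξ * τ))
        + ε * (1 / 1000) * (4 * (ξ * υ) + 6 * (ξ * τ) + 6 * (β * υ) + 9 * (β * τ)) := by gcongr
    _ = ε * (4 * (ξ * υ) + 3 * (β * υ) + 3 * (ξ * τ)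
        + (1 / 1000) * (4 * (ξ * υ) + 6 * (ξ * τ) + 6 * (β * υ) + 9 * (β * τ))) := by ring
    _ ≤ _ := by
      refine mul_le_mul_of_nonneg_left ?_ he
      have : 0 ≤ ξ * υ := by positivity
      have : 0 ≤ β * τ := by positivity
      have : 0 ≤ α * τ := by positivity
      have : 0 ≤ β * γ := by positivity
      linarith

end Rounding

end GKO

/-! ### The residual of one elimination step -/

namespace GKO

section Elimination

variable {n : ℕ} {ε : ℝ}

lemma gens_fst_eq_zero (fl : FloatArith ε) (C : CauchyData n) {k : ℕ} {i : Fin n}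
    (h : (i : ℕ) < k) (a : Fin 2) : (gens fl C k).1 i a = 0 := by
  obtain _ | k := k
  · omega
  rw [gens]
  split_ifs with hk
  · have : ¬ (⟨k, hk⟩ : Fin n) < i := by simp only [Fin.lt_def]; omega
    simp [flStep, this]
  · rfl

lemma gens_snd_eq_zero (fl : FloatArith ε) (C : CauchyData n) {k : ℕ} {j : Fin n}
    (h : (j : ℕ) < k) (a : Fin 2) : (gens fl C k).2 a j = 0 := by
  obtain _ | k := k
  · omega
  rw [gens]
  split_ifs with hk
  · have : ¬ (⟨k, hk⟩ : Fin n) < j := by simp only [Fin.lt_def]; omega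
    simp [flStep, this]
  · rfl

/-- The entry `(Φ Ψ)_ij` for the computed generators at step `k`; it is the displacement
`(t_i - s_j) r_ij^{(k)}` of the reduced matrix that these generators define. -/
def genProd (fl : FloatArith ε) (C : CauchyData n) (k : ℕ) (i j : Fin n) : ℂ :=
  ((gens fl C k).1 * (gens fl C k).2) i j

lemma genProd_eq_zero_left (fl : FloatArith ε) (C : CauchyData n) {k : ℕ} {i : Fin n}
    (h : (i : ℕ) < k) (j : Fin n) : genProd fl C k i j = 0 := by
  simp [genProd, Matrix.mul_apply, gens_fst_eq_zero fl C h]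

lemma genProd_eq_zero_right (fl : FloatArith ε) (C : CauchyData n) {k : ℕ} {j : Fin n}
    (h : (j : ℕ) < k) (i : Fin n) : genProd fl C k i j = 0 := by
  simp [genProd, Matrix.mul_apply, gens_snd_eq_zero fl C h]

lemma absMul_gens_eq_zero (fl : FloatArith ε) (C : CauchyData n) {k : ℕ} {i : Fin n}
    (h : (i : ℕ) < k) (j : Fin n) : absMul (gens fl C k) i j = 0 := by
  simp [absMul, gens_fst_eq_zero fl C h]

lemma absMul_gens_eq (fl : FloatArith ε) {C : CauchyData n} (hV : VDefined fl C) (k i j : Fin n) :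
    absMul (gens fl C k) i j = ‖V fl C k i j‖ * ‖genProd fl C k i j‖ := by
  have h : ((absMul (gens fl C k) i j : ℝ) : ℂ) = V fl C k i j * genProd fl C k i j := hV k i j
  have := congrArg norm h
  rwa [norm_mul, Complex.norm_real, Real.norm_eq_abs, abs_of_nonneg (absMul_nonneg _ i j)] at this

/-- The hypotheses on the rounding unit, the nodes and the matrices `V^{(k)}` that the error
analysis of a single step uses. -/
structure Admissible (fl : FloatArith ε) (C : CauchyData n) : Prop where
  ne : ∀ i j, C.t i ≠ C.s j
  pivoted : Pivoted fl C
  vDefined : VDefined fl C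
  eps_le : ε ≤ 1 / 1000
  le : ∀ k i j : Fin n, n * ε * ‖V fl C k i j‖ ≤ 1 / 1000

variable {fl : FloatArith ε} {C : CauchyData n}

lemma Admissible.eps_mul_V_le (h : Admissible fl C) (k i j : Fin n) :
    ε * ‖V fl C k i j‖ ≤ 1 / 1000 := by
  refine le_trans ?_ (h.le k i j)
  have h1 : (1 : ℝ) ≤ n := by exact_mod_cast (Nat.one_le_of_lt k.2)
  rw [mul_assoc]
  exact le_mul_of_one_le_left (mul_nonneg fl.eps_nonneg (norm_nonneg _)) h1

/-- The growth factors `V^{(k)}` convert the absolute size of the generators into the size of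
the computed entry. -/
lemma Admissible.absMul_le (h : Admissible fl C) (k i j : Fin n) :
    absMul (gens fl C k) i j
      ≤ 2 * (‖V fl C k i j‖ * ‖C.t i - C.s j‖ * ‖compR fl C k i j‖) := by
  have h1 := norm_flEntry_sub_le h.eps_le fl C (gens fl C k) i j (h.ne i j)
  have h2 := absMul_gens_eq fl h.vDefined k i j
  have h3 := h.eps_mul_V_le k i j
  change ‖_ * compR fl C k i j - genProd fl C k i j‖ ≤ _ at h1
  have h4 := norm_sub_norm_le (genProd fl C k i j) ((C.t i - C.s j) * compR fl C k i j)
  rw [norm_sub_rev, norm_mul] at h4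
  have h5 : 5 * ε * absMul (gens fl C k) i j ≤ 5 * (1 / 1000) * ‖genProd fl C k i j‖ := by
    rw [h2, show 5 * ε * (‖V fl C k i j‖ * ‖genProd fl C k i j‖)
      = 5 * (ε * ‖V fl C k i j‖) * ‖genProd fl C k i j‖ by ring]
    gcongr
  have h6 : ‖genProd fl C k i j‖ ≤ 2 * (‖C.t i - C.s j‖ * ‖compR fl C k i j‖) := by
    linarith [norm_nonneg (genProd fl C k i j)]
  calc _ = _ := h2
    _ ≤ ‖V fl C k i j‖ * (2 * (‖C.t i - C.s j‖ * ‖compR fl C k i j‖)) := by gcongr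
    _ = _ := by ring

/-- The contribution of step `k` to the displacement of `L U - R`. It vanishes in exact
arithmetic. -/
def residual (fl : FloatArith ε) (C : CauchyData n) (k i j : Fin n) : ℂ :=
  (C.t i - C.s j) * (compL fl C i k * compU fl C k j) - genProd fl C k i j
    + genProd fl C (k + 1) i j

/-- The part of the bound on `residual` that comes from column `k` of `L` and row `k` of `U`. -/
noncomputable def stepBound (fl : FloatArith ε) (C : CauchyData n) (k i j : Fin n) : ℝ :=
  (‖V fl C k i k‖ * ‖C.t i - C.s k‖ + ‖V fl C k k j‖ * ‖C.t k - C.s j‖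
    + ‖V fl C k k k‖ * ‖C.t k - C.s k‖) * (‖compL fl C i k‖ * ‖compU fl C k j‖)

lemma stepBound_nonneg (k i j : Fin n) : 0 ≤ stepBound fl C k i j := by
  unfold stepBound; positivity

lemma compU_apply {k j : Fin n} (h : k ≤ j) : compU fl C k j = compR fl C k k j := by
  simp [compU, h]

lemma compL_apply {i k : Fin n} (h : k < i) :
    compL fl C i k = flMult fl C (gens fl C k) i k := by
  simp [compL, h]

lemma compL_self (k : Fin n) : compL fl C k k = 1 := by
  simp [compL]

lemma gens_succ (k : Fin n) : gens fl C ((k : ℕ) + 1) = flStep fl C k (gens fl C k) := by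
  rw [gens, dif_pos k.2]

/-- The error of the computed entry in row `k`, as an error in the displacement. -/
lemma Admissible.norm_pivotRow_sub_le (h : Admissible fl C) {k j : Fin n} (hkj : k ≤ j) :
    ‖(C.t k - C.s j) * compU fl C k j - genProd fl C k k j‖
      ≤ 5 * ε * absMul (gens fl C k) k j := by
  rw [compU_apply hkj]
  exact norm_flEntry_sub_le h.eps_le fl C (gens fl C k) k j (h.ne k j)

/-- The error of the multiplier `l_ik`, as an error in the displacement of column `k`, together
with the bound on the generators in column `k` by the computed factors. -/
lemma Admissible.norm_pivotCol_sub_le (h : Admissible fl C) {i k : Fin n} (hki : k < i) :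
    ‖(C.t i - C.s k) * (compL fl C i k * compU fl C k k) - genProd fl C k i k‖
        ≤ 7 * ε * absMul (gens fl C k) i k ∧
      absMul (gens fl C k) i k ≤ 4 * (‖V fl C k i k‖ * ‖C.t i - C.s k‖
        * (‖compL fl C i k‖ * ‖compU fl C k k‖)) := by
  have he := fl.eps_nonneg
  have hu : compR fl C k k k ≠ 0 := h.pivoted.pivot_ne k (by have := i.2; omega)
  obtain ⟨δ, hδ, e⟩ := fl.div_spec (compR fl C k i k) (compR fl C k k k) hu
  have h1δ := le_norm_one_add h.eps_le hδ
  have hl : compL fl C i k * compU fl C k k = compR fl C k i k * (1 + δ) := by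
    rw [compL_apply hki, compU_apply le_rfl, flMult]
    change fl.div (compR fl C k i k) (compR fl C k k k) * _ = _
    rw [e]
    field_simp
  have h1 := norm_flEntry_sub_le h.eps_le fl C (gens fl C k) i k (h.ne i k)
  change ‖_ * compR fl C k i k - genProd fl C k i k‖ ≤ _ at h1
  have hp : ‖genProd fl C k i k‖ ≤ _ := norm_mul_apply_le_absMul (gens fl C k) i k
  have hw := absMul_nonneg (gens fl C k) i k
  constructor
  · rw [hl, show (C.t i - C.s k) * (compR fl C k i k * (1 + δ)) - genProd fl C k i k
      = ((C.t i - C.s k) * compR fl C k i k - genProd fl C k i k)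
        + ((C.t i - C.s k) * compR fl C k i k - genProd fl C k i k) * δ
        + genProd fl C k i k * δ by ring]
    refine norm_add₃_le.trans ?_
    have h2 := norm_mul_le_mul_norm hδ
      ((C.t i - C.s k) * compR fl C k i k - genProd fl C k i k)
    have h3 := norm_mul_le_mul_norm hδ (genProd fl C k i k)
    have h4 := mul_le_mul_of_nonneg_left h1 he
    have h5 := mul_le_mul_of_nonneg_left hp he
    have h6 : ε * (5 * ε * absMul (gens fl C k) i k)
        ≤ ε * (5 * (1 / 1000) * absMul (gens fl C k) i k) := by
      gcongr; exact h.eps_le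
    have := mul_nonneg he hw
    linarith
  · rw [← norm_mul (compL fl C i k), hl, norm_mul]
    refine (h.absMul_le k i k).trans ?_
    have hx : ‖compR fl C k i k‖ ≤ 2 * (‖compR fl C k i k‖ * ‖1 + δ‖) := by
      nlinarith [norm_nonneg (compR fl C k i k)]
    calc 2 * (‖V fl C k i k‖ * ‖C.t i - C.s k‖ * ‖compR fl C k i k‖)
        ≤ 2 * (‖V fl C k i k‖ * ‖C.t i - C.s k‖ * (2 * (‖compR fl C k i k‖ * ‖1 + δ‖))) := by
          gcongr
      _ = _ := by ring

/-- The rounding errors of the generator update, with the terms of the exact update collected in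
the entries of `|Φ| |Ψ|` at step `k`. -/
lemma Admissible.norm_genProd_succ_sub_le (h : Admissible fl C) {k i j : Fin n}
    (hi : k < i) (hj : k < j) :
    ‖genProd fl C (k + 1) i j
        - (genProd fl C k i j - compL fl C i k * genProd fl C k k j
          - compU fl C k j / compU fl C k k * genProd fl C k i k
          + compL fl C i k * (compU fl C k j / compU fl C k k) * genProd fl C k k k)‖
      ≤ ε * (5 * absMul (gens fl C (k + 1)) i j
        + 13 * (‖compU fl C k j / compU fl C k k‖ * absMul (gens fl C k) i k
          + ‖compL fl C i k‖ * absMul (gens fl C k) k j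
          + ‖compL fl C i k‖ * ‖compU fl C k j / compU fl C k k‖
            * absMul (gens fl C k) k k)) := by
  have he := fl.eps_nonneg
  have hu : compR fl C k k k ≠ 0 := h.pivoted.pivot_ne k (by have := i.2; omega)
  set g := gens fl C k with hg
  set g' := gens fl C (k + 1) with hg'
  set l := compL fl C i k with hl
  set q := compU fl C k j / compU fl C k k with hq
  have hX : ∀ a, ‖g'.1 i a - (g.1 i a - g.1 k a * l)‖
      ≤ 2 * ε * ‖g'.1 i a‖ + 3 * ε * ‖g.1 k a * l‖ := by
    intro a
    have e : g'.1 i a = fl.sub (g.1 i a) (fl.mul (g.1 k a) l) := by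
      rw [hg', gens_succ, hl, compL_apply hi]
      simp [flStep, hi, hg]
    rw [e]
    exact norm_left_update_sub_le h.eps_le fl _ _ _
  have hY : ∀ a, ‖g'.2 a j - (g.2 a j - g.2 a k * q)‖
      ≤ 2 * ε * ‖g'.2 a j‖ + 3 * ε * ‖g.2 a k * q‖ := by
    intro a
    have e : g'.2 a j = fl.sub (g.2 a j)
        (fl.div (fl.mul (g.2 a k) (compR fl C k k j)) (compR fl C k k k)) := by
      rw [hg', gens_succ]
      simp [flStep, hj, hg, compR]
    rw [e, hq, compU_apply hj.le, compU_apply le_rfl]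
    exact norm_right_update_sub_le h.eps_le fl _ _ _ _ hu
  have h0 := norm_update_mul_sub_le h.eps_le he (hX 0) (hY 0)
  have h1 := norm_update_mul_sub_le h.eps_le he (hX 1) (hY 1)
  have key : genProd fl C (k + 1) i j - (genProd fl C k i j - l * genProd fl C k k j
      - q * genProd fl C k i k + l * q * genProd fl C k k k)
      = (g'.1 i 0 * g'.2 0 j - (g.1 i 0 - g.1 k 0 * l) * (g.2 0 j - g.2 0 k * q))
        + (g'.1 i 1 * g'.2 1 j - (g.1 i 1 - g.1 k 1 * l) * (g.2 1 j - g.2 1 k * q)) := by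
    simp only [genProd, Matrix.mul_apply, Fin.sum_univ_two, ← hg, ← hg']
    ring
  rw [key]
  refine (norm_add_le _ _).trans ((add_le_add h0 h1).trans_eq ?_)
  simp only [absMul, Fin.sum_univ_two]
  ring

lemma norm_residual_terms_le (q l x₁ x₂ x₃ x₄ : ℂ) :
    ‖q * x₁ + l * x₂ - l * q * x₃ + x₄‖
      ≤ ‖q‖ * ‖x₁‖ + ‖l‖ * ‖x₂‖ + ‖l‖ * ‖q‖ * ‖x₃‖ + ‖x₄‖ := by
  simp only [← norm_mul]
  refine (norm_add_le _ _).trans ?_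
  gcongr
  refine (norm_sub_le _ _).trans ?_
  gcongr
  exact norm_add_le _ _

/-- The residual of a step is small relative to the computed factors and to the generators of
the next step. -/
lemma Admissible.norm_residual_le (h : Admissible fl C) (k i j : Fin n) :
    ‖residual fl C k i j‖
      ≤ ε * (5 * absMul (gens fl C (k + 1)) i j + 80 * stepBound fl C k i j) := by
  have he := fl.eps_nonneg
  have hnn : 0 ≤ ε * (5 * absMul (gens fl C (k + 1)) i j + 80 * stepBound fl C k i j) :=
    mul_nonneg he (by linarith [absMul_nonneg (gens fl C (k + 1)) i j,
      stepBound_nonneg (fl := fl) (C := C) k i j])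
  rcases lt_trichotomy i k with hik | rfl | hki
  · have h1 : compL fl C i k = 0 := by simp [compL, hik.not_gt, hik.ne]
    have h2 : genProd fl C k i j = 0 := genProd_eq_zero_left fl C (by exact hik) j
    have h3 : genProd fl C (k + 1) i j = 0 :=
      genProd_eq_zero_left fl C (by have : (i : ℕ) < k := hik; omega) j
    simpa [residual, h1, h2, h3] using hnn
  · have h3 : genProd fl C (i + 1) i j = 0 := genProd_eq_zero_left fl C (by omega) j
    rcases lt_or_ge j i with hji | hij
    · have h1 : compU fl C i j = 0 := by simp [compU, hji.not_ge]
      have h2 : genProd fl C i i j = 0 := genProd_eq_zero_right fl C (by exact hji) i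
      simpa [residual, h1, h2, h3] using hnn
    · have h4 := h.norm_pivotRow_sub_le hij
      have h5 := h.absMul_le i i j
      rw [← compU_apply hij] at h5
      have h6 : ‖V fl C i i j‖ * ‖C.t i - C.s j‖ * ‖compU fl C i j‖ ≤ stepBound fl C i i j := by
        rw [stepBound, compL_self, norm_one, one_mul]
        gcongr
        linarith [mul_nonneg (norm_nonneg (V fl C i i i)) (norm_nonneg (C.t i - C.s i))]
      rw [residual, h3, compL_self, one_mul, add_zero]
      have h7 := mul_le_mul_of_nonneg_left (h5.trans (mul_le_mul_of_nonneg_left h6 two_pos.le)) he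
      have := mul_nonneg he (absMul_nonneg (gens fl C (i + 1)) i j)
      have := mul_nonneg he (stepBound_nonneg (fl := fl) (C := C) i i j)
      linarith
  · have hu : compU fl C k k ≠ 0 := by
      rw [compU_apply le_rfl]; exact h.pivoted.pivot_ne k (by have := i.2; omega)
    obtain ⟨h1, h2⟩ := h.norm_pivotCol_sub_le hki
    rcases lt_trichotomy j k with hjk | rfl | hkj
    · have h4 : compU fl C k j = 0 := by simp [compU, hjk.not_ge]
      have h5 : genProd fl C k i j = 0 := genProd_eq_zero_right fl C (by exact hjk) i
      have h6 : genProd fl C (k + 1) i j = 0 :=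
        genProd_eq_zero_right fl C (by have : (j : ℕ) < k := hjk; omega) i
      simpa [residual, h4, h5, h6] using hnn
    · have h3 : genProd fl C (j + 1) i j = 0 := genProd_eq_zero_right fl C (by omega) i
      have h6 : ‖V fl C j i j‖ * ‖C.t i - C.s j‖ * (‖compL fl C i j‖ * ‖compU fl C j j‖)
          ≤ stepBound fl C j i j := by
        rw [stepBound]
        gcongr
        linarith [mul_nonneg (norm_nonneg (V fl C j j j)) (norm_nonneg (C.t j - C.s j))]
      rw [residual, h3, add_zero]
      have h7 := mul_le_mul_of_nonneg_left (h2.trans (mul_le_mul_of_nonneg_left h6 four_pos.le)) he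
      have := mul_nonneg he (absMul_nonneg (gens fl C (j + 1)) i j)
      have := mul_nonneg he (stepBound_nonneg (fl := fl) (C := C) j i j)
      linarith
    · have h3 := h.norm_genProd_succ_sub_le hki hkj
      have h4 := h.norm_pivotRow_sub_le hkj.le
      have h5 := h.norm_pivotRow_sub_le (le_refl k)
      have h6 := h.absMul_le k k j
      have h7 := h.absMul_le k k k
      rw [← compU_apply hkj.le] at h6
      rw [← compU_apply le_rfl] at h7
      -- the exact update terms cancel, and only the four kinds of rounding errors remain
      have hdec : residual fl C k i j
          = compU fl C k j / compU fl C k k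
              * ((C.t i - C.s k) * (compL fl C i k * compU fl C k k) - genProd fl C k i k)
            + compL fl C i k * ((C.t k - C.s j) * compU fl C k j - genProd fl C k k j)
            - compL fl C i k * (compU fl C k j / compU fl C k k)
              * ((C.t k - C.s k) * compU fl C k k - genProd fl C k k k)
            + (genProd fl C (k + 1) i j
              - (genProd fl C k i j - compL fl C i k * genProd fl C k k j
                - compU fl C k j / compU fl C k k * genProd fl C k i k
                + compL fl C i k * (compU fl C k j / compU fl C k k) * genProd fl C k k k)) := by
        rw [residual]
        field_simp
        ring
      have hq : ‖compU fl C k j / compU fl C k k‖ * ‖compU fl C k k‖ = ‖compU fl C k j‖ := by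
        rw [← norm_mul, div_mul_cancel₀ _ hu]
      rw [stepBound, ← hq]
      rw [← hq] at h6
      have hq0 := norm_nonneg (compU fl C k j / compU fl C k k)
      rw [hdec]
      refine (norm_residual_terms_le _ _ _ _ _ _).trans ?_
      generalize ‖compU fl C k j / compU fl C k k‖ = q at *
      have hl0 := norm_nonneg (compL fl C i k)
      generalize ‖compL fl C i k‖ = l at *
      have e1 := mul_le_mul_of_nonneg_left h1 hq0
      have e2 := mul_le_mul_of_nonneg_left h4 hl0
      have e3 := mul_le_mul_of_nonneg_left h5 (mul_nonneg hl0 hq0)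
      have f1 := mul_le_mul_of_nonneg_left h2 (mul_nonneg he hq0)
      have f2 := mul_le_mul_of_nonneg_left h6 (mul_nonneg he hl0)
      have f3 := mul_le_mul_of_nonneg_left h7 (mul_nonneg he (mul_nonneg hl0 hq0))
      have n2 : 0 ≤ ε * l * (‖V fl C k k j‖ * ‖C.t k - C.s j‖ * (q * ‖compU fl C k k‖)) := by
        positivity
      have n3 : 0 ≤ ε * (l * q) * (‖V fl C k k k‖ * ‖C.t k - C.s k‖ * ‖compU fl C k k‖) := by
        positivity
      linarith

end Elimination

end GKO

/-! ### Accumulation of the residuals and Frobenius norms -/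

namespace GKO

section Accumulation

variable {n : ℕ} {ε : ℝ} {fl : FloatArith ε} {C : CauchyData n}

lemma sum_Ici_succ_sub (f : ℕ → ℂ) (k : Fin n) :
    ∑ m ∈ Finset.Ici k, (f (m + 1) - f m) = f n - f k := by
  rw [← Finset.sum_Ico_sub f k.2.le, ← Fin.map_valEmbedding_Ici, Finset.sum_map]
  rfl

lemma sum_succ_eq_sum_filter_pos (f : ℕ → ℝ) (hf : f n = 0) :
    ∑ m : Fin n, f (m + 1) = ∑ m ∈ Finset.univ.filter (fun m : Fin n => 0 < (m : ℕ)), f m := by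
  rw [Finset.sum_filter]
  rw [Fin.sum_univ_eq_sum_range (fun m => f (m + 1)) n,
    Fin.sum_univ_eq_sum_range (fun m => if 0 < m then f m else 0) n]
  have h1 := Finset.sum_range_succ (fun m => if 0 < m then f m else 0) n
  have h2 := Finset.sum_range_succ' (fun m => if 0 < m then f m else 0) n
  simp only [hf, ite_self, add_zero, lt_irrefl, if_false, Nat.succ_pos, if_true] at h1 h2
  exact h2.symm.trans h1

/-- Telescoping of the residuals: the displacement of `R_k` is `Φ Ψ` at step `k` up to the
residuals of the later steps. -/
lemma sub_mul_trailing (k i j : Fin n) :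
    (C.t i - C.s j) * trailing fl C k i j
      = genProd fl C k i j + ∑ m ∈ Finset.Ici k, residual fl C m i j := by
  have h := sum_Ici_succ_sub (fun m => genProd fl C m i j) k
  have hn : genProd fl C n i j = 0 := genProd_eq_zero_left fl C i.2 j
  rw [hn] at h
  have : ∑ m ∈ Finset.Ici k, residual fl C m i j
      = (C.t i - C.s j) * trailing fl C k i j
        + ∑ m ∈ Finset.Ici k, (genProd fl C (m + 1) i j - genProd fl C m i j) := by
    rw [trailing, Matrix.of_apply, Finset.mul_sum, ← Finset.sum_add_distrib]
    refine Finset.sum_congr rfl fun m _ => ?_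
    rw [residual]
    ring
  rw [this, h]
  ring

lemma sub_mul_apply_of_generates {R : Matrix (Fin n) (Fin n) ℂ} (hR : C.Generates R)
    (i j : Fin n) : (C.t i - C.s j) * R i j = (C.Φ * C.Ψ) i j := by
  rw [← hR.2, Matrix.sub_apply, Matrix.diagonal_mul, Matrix.mul_diagonal]
  ring

lemma sub_mul_backwardError {R : Matrix (Fin n) (Fin n) ℂ} (hR : C.Generates R) (i j : Fin n) :
    (C.t i - C.s j) * backwardError fl C R i j = ∑ m, residual fl C m i j := by
  have hpos : 0 < n := i.pos
  have h := sub_mul_trailing (fl := fl) (C := C) ⟨0, hpos⟩ i j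
  have hu : Finset.Ici (⟨0, hpos⟩ : Fin n) = Finset.univ := by
    ext m; simp [Fin.le_def]
  have ht : trailing fl C ⟨0, hpos⟩ i j = (compL fl C * compU fl C) i j := by
    rw [trailing, Matrix.of_apply, hu, Matrix.mul_apply]
  have hg : genProd fl C 0 i j = (C.Φ * C.Ψ) i j := rfl
  rw [hu, ht] at h
  change _ = genProd fl C 0 i j + _ at h
  rw [backwardError, Matrix.sub_apply, mul_sub, h, sub_mul_apply_of_generates hR, hg]
  ring

/-- The sum of all residuals at one position. The generators of step `m` are bounded by `R_m` and
the residuals of the later steps; since `n ε |v|` is small, the latter are absorbed. -/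
lemma Admissible.sum_norm_residual_le (h : Admissible fl C) (i j : Fin n) :
    ∑ m, ‖residual fl C m i j‖ ≤ 160 * ε * (∑ m, stepBound fl C m i j
      + ‖C.t i - C.s j‖ *
          ∑ m ∈ Finset.univ.filter (fun m : Fin n => 0 < (m : ℕ)), ‖hatR fl C m i j‖) := by
  have he := fl.eps_nonneg
  have hn : (0 : ℝ) < n := by exact_mod_cast i.pos
  set S := ∑ m, ‖residual fl C m i j‖ with hS
  have hS0 : 0 ≤ S := Finset.sum_nonneg fun _ _ => norm_nonneg _
  -- the factor `ε |v|` of the residuals is at most `1 / (1000 n)`; the `n` steps share `S / 1000`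
  have hW : ∀ m : Fin n, ε * absMul (gens fl C m) i j
      ≤ ε * (‖C.t i - C.s j‖ * ‖hatR fl C m i j‖) + 1 / 1000 * S / n := by
    intro m
    have h1 : genProd fl C m i j = (C.t i - C.s j) * trailing fl C m i j
        - ∑ m' ∈ Finset.Ici m, residual fl C m' i j := by
      rw [sub_mul_trailing]; ring
    have h2 : ‖∑ m' ∈ Finset.Ici m, residual fl C m' i j‖ ≤ S :=
      (norm_sum_le _ _).trans (Finset.sum_le_sum_of_subset_of_nonneg (Finset.subset_univ _)
        fun _ _ _ => norm_nonneg _)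
    have h3 : ‖genProd fl C m i j‖ ≤ ‖C.t i - C.s j‖ * ‖trailing fl C m i j‖ + S := by
      rw [h1, ← norm_mul]
      exact (norm_sub_le _ _).trans (by gcongr)
    have h4 : ‖hatR fl C m i j‖ = ‖V fl C m i j‖ * ‖trailing fl C m i j‖ := by
      rw [hatR, Matrix.of_apply, norm_mul]
    have h5 := h.le m i j
    rw [absMul_gens_eq fl h.vDefined, h4]
    calc ε * (‖V fl C m i j‖ * ‖genProd fl C m i j‖)
        ≤ ε * (‖V fl C m i j‖ * (‖C.t i - C.s j‖ * ‖trailing fl C m i j‖ + S)) := by gcongr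
      _ = ε * (‖C.t i - C.s j‖ * (‖V fl C m i j‖ * ‖trailing fl C m i j‖))
          + n * ε * ‖V fl C m i j‖ * S / n := by field_simp
      _ ≤ _ := by gcongr
  have hsum : ε * ∑ m : Fin n, absMul (gens fl C (m + 1)) i j
      ≤ ε * (‖C.t i - C.s j‖ *
          ∑ m ∈ Finset.univ.filter (fun m : Fin n => 0 < (m : ℕ)), ‖hatR fl C m i j‖)
        + 1 / 1000 * S := by
    rw [sum_succ_eq_sum_filter_pos (fun m => absMul (gens fl C m) i j)
      (absMul_gens_eq_zero fl C i.2 j), Finset.mul_sum]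
    refine (Finset.sum_le_sum fun m _ => hW m).trans ?_
    rw [Finset.sum_add_distrib, ← Finset.mul_sum, ← Finset.mul_sum]
    gcongr
    rw [Finset.sum_const, nsmul_eq_mul]
    have hc : ((Finset.univ.filter fun m : Fin n => 0 < (m : ℕ)).card : ℝ) ≤ n := by
      exact_mod_cast (Finset.card_le_univ _).trans_eq (Fintype.card_fin n)
    calc _ ≤ (n : ℝ) * (1 / 1000 * S / n) := by gcongr
      _ = _ := by field_simp
  have htot : S ≤ 5 * (ε * ∑ m : Fin n, absMul (gens fl C (m + 1)) i j)
      + 80 * ε * ∑ m, stepBound fl C m i j := by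
    refine (Finset.sum_le_sum fun m _ => h.norm_residual_le m i j).trans_eq ?_
    rw [← Finset.mul_sum, Finset.sum_add_distrib, ← Finset.mul_sum, ← Finset.mul_sum]
    ring
  have hA : 0 ≤ ε * ∑ m, stepBound fl C m i j :=
    mul_nonneg he (Finset.sum_nonneg fun _ _ => stepBound_nonneg _ _ _)
  have hB : 0 ≤ ε * (‖C.t i - C.s j‖ *
      ∑ m ∈ Finset.univ.filter (fun m : Fin n => 0 < (m : ℕ)), ‖hatR fl C m i j‖) := by
    positivity
  linarith

lemma norm_B_apply (i j : Fin n) : ‖C.B i j‖ = 1 / ‖C.t i - C.s j‖ := by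
  simp [CauchyData.B]

lemma bMin_pos [NeZero n] (h : ∀ i j, C.t i ≠ C.s j) : 0 < C.bMin := by
  obtain ⟨p, hp⟩ := exists_eq_ciInf_of_finite (f := fun p : Fin n × Fin n => ‖C.B p.1 p.2‖)
  rw [CauchyData.bMin, ← hp]
  have : C.t p.1 - C.s p.2 ≠ 0 := sub_ne_zero.mpr (h _ _)
  rw [norm_B_apply]
  positivity

lemma le_bMax (i j : Fin n) : 1 / ‖C.t i - C.s j‖ ≤ C.bMax := by
  rw [← norm_B_apply]
  exact le_ciSup (f := fun p : Fin n × Fin n => ‖C.B p.1 p.2‖) (Set.finite_range _).bddAbove (i, j)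

lemma bMin_le (i j : Fin n) : C.bMin ≤ 1 / ‖C.t i - C.s j‖ := by
  rw [← norm_B_apply]
  exact ciInf_le (f := fun p : Fin n × Fin n => ‖C.B p.1 p.2‖) (Set.finite_range _).bddBelow (i, j)

lemma bRatio_nonneg : 0 ≤ C.bMax / C.bMin :=
  div_nonneg (Real.iSup_nonneg fun _ => norm_nonneg _) (Real.iInf_nonneg fun _ => norm_nonneg _)

lemma norm_sub_le_bRatio_mul [NeZero n] (h : ∀ i j, C.t i ≠ C.s j) (i j k l : Fin n) :
    ‖C.t i - C.s j‖ ≤ C.bMax / C.bMin * ‖C.t k - C.s l‖ := by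
  have h1 : 0 < ‖C.t i - C.s j‖ := norm_pos_iff.mpr (sub_ne_zero.mpr (h _ _))
  have h2 : 0 < ‖C.t k - C.s l‖ := norm_pos_iff.mpr (sub_ne_zero.mpr (h _ _))
  have h3 := bMin_pos h
  have h4 := le_bMax (C := C) k l
  have h5 := bMin_le (C := C) i j
  rw [div_le_iff₀ h2] at h4
  rw [le_div_iff₀ h1] at h5
  rw [div_mul_eq_mul_div, le_div_iff₀ h3]
  linarith

/-- The matrix of moduli. -/
noncomputable def modulus (A : Matrix (Fin n) (Fin n) ℂ) : Matrix (Fin n) (Fin n) ℝ :=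
  A.map norm

@[simp] lemma modulus_apply (A : Matrix (Fin n) (Fin n) ℂ) (i j : Fin n) :
    modulus A i j = ‖A i j‖ := rfl

lemma norm_modulus (A : Matrix (Fin n) (Fin n) ℂ) : ‖modulus A‖ = ‖A‖ :=
  Matrix.frobenius_norm_map_eq A norm fun _ => norm_norm _

lemma frobenius_norm_mono {𝕜 𝕜' : Type*} [NormedAddCommGroup 𝕜] [NormedAddCommGroup 𝕜']
    {A : Matrix (Fin n) (Fin n) 𝕜} {B : Matrix (Fin n) (Fin n) 𝕜'}
    (h : ∀ i j, ‖A i j‖ ≤ ‖B i j‖) : ‖A‖ ≤ ‖B‖ := by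
  rw [Matrix.frobenius_norm_def, Matrix.frobenius_norm_def]
  gcongr with i _ j _
  exact h i j

lemma frobenius_norm_const_mul (c : ℝ) (A : Matrix (Fin n) (Fin n) ℝ) : ‖c • A‖ = |c| * ‖A‖ := by
  let _ := Matrix.frobeniusNormedSpace (m := Fin n) (n := Fin n) (R := ℝ) (α := ℝ)
  rw [norm_smul, Real.norm_eq_abs]

/-- Entrywise bound on the backward error in terms of the matrices of which the growth factors
are composed. -/
lemma Admissible.norm_backwardError_apply_le [NeZero n] (h : Admissible fl C)
    {R : Matrix (Fin n) (Fin n) ℂ} (hR : C.Generates R) (i j : Fin n) :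
    ‖backwardError fl C R i j‖ ≤ ((160 * ε) • ((C.bMax / C.bMin) •
      (modulus (hatL fl C) * modulus (compU fl C) + modulus (compL fl C) * modulus (hatU fl C)
        + modulus (compL fl C) * (modulus (Matrix.diagonal fun k => V fl C k k k)
          * modulus (compU fl C)))
      + ∑ m ∈ Finset.univ.filter (fun m : Fin n => 0 < (m : ℕ)), modulus (hatR fl C m))) i j := by
  have he := fl.eps_nonneg
  have hd : 0 < ‖C.t i - C.s j‖ := norm_pos_iff.mpr (sub_ne_zero.mpr (h.ne i j))
  set ρ := C.bMax / C.bMin with hρ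
  have hρ0 : 0 ≤ ρ := bRatio_nonneg
  have h1 := (norm_sum_le _ _).trans (h.sum_norm_residual_le i j)
  rw [← sub_mul_backwardError hR, norm_mul] at h1
  have h2 : ∑ m, stepBound fl C m i j ≤ ‖C.t i - C.s j‖ * (ρ * ∑ m : Fin n,
      (‖hatL fl C i m‖ * ‖compU fl C m j‖ + ‖compL fl C i m‖ * ‖hatU fl C m j‖
        + ‖compL fl C i m‖ * (‖V fl C m m m‖ * ‖compU fl C m j‖))) := by
    rw [← mul_assoc, Finset.mul_sum]
    refine Finset.sum_le_sum fun m _ => ?_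
    have e1 : ‖hatL fl C i m‖ = ‖V fl C m i m‖ * ‖compL fl C i m‖ := by
      rw [hatL, Matrix.of_apply, norm_mul]
    have e2 : ‖hatU fl C m j‖ = ‖compU fl C m j‖ * ‖V fl C m m j‖ := by
      rw [hatU, Matrix.of_apply, norm_mul]
    have b := fun k l => norm_sub_le_bRatio_mul h.ne k l i j
    rw [stepBound, e1, e2]
    calc _ ≤ (‖V fl C m i m‖ * (ρ * ‖C.t i - C.s j‖) + ‖V fl C m m j‖ * (ρ * ‖C.t i - C.s j‖)
          + ‖V fl C m m m‖ * (ρ * ‖C.t i - C.s j‖)) * (‖compL fl C i m‖ * ‖compU fl C m j‖) := by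
          gcongr
          · exact b i m
          · exact b m j
          · exact b m m
      _ = _ := by ring
  have h3 : ‖C.t i - C.s j‖ * ‖backwardError fl C R i j‖ ≤ ‖C.t i - C.s j‖ * (160 * ε *
      (ρ * ∑ m : Fin n,
      (‖hatL fl C i m‖ * ‖compU fl C m j‖ + ‖compL fl C i m‖ * ‖hatU fl C m j‖
        + ‖compL fl C i m‖ * (‖V fl C m m m‖ * ‖compU fl C m j‖))
        + ∑ m ∈ Finset.univ.filter (fun m : Fin n => 0 < (m : ℕ)), ‖hatR fl C m i j‖)) := by
    refine h1.trans ?_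
    calc _ ≤ 160 * ε * (‖C.t i - C.s j‖ * (ρ * ∑ m : Fin n,
          (‖hatL fl C i m‖ * ‖compU fl C m j‖ + ‖compL fl C i m‖ * ‖hatU fl C m j‖
          + ‖compL fl C i m‖ * (‖V fl C m m m‖ * ‖compU fl C m j‖)))
          + ‖C.t i - C.s j‖ *
              ∑ m ∈ Finset.univ.filter (fun m : Fin n => 0 < (m : ℕ)), ‖hatR fl C m i j‖) := by gcongr
      _ = _ := by ring
  refine (le_of_mul_le_mul_left h3 hd).trans_eq ?_
  have hdiag : ∀ m, (modulus (Matrix.diagonal fun k => V fl C k k k) * modulus (compU fl C)) m j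
      = ‖V fl C m m m‖ * ‖compU fl C m j‖ := fun m => by
    rw [show modulus (Matrix.diagonal fun k => V fl C k k k)
      = Matrix.diagonal fun k => ‖V fl C k k k‖ from Matrix.diagonal_map norm_zero,
      Matrix.diagonal_mul, modulus_apply]
  rw [Matrix.smul_apply, Matrix.add_apply, Matrix.smul_apply, Matrix.add_apply, Matrix.add_apply,
    Matrix.mul_apply, Matrix.mul_apply, Matrix.mul_apply, Matrix.sum_apply]
  simp only [hdiag, modulus_apply, smul_eq_mul, Finset.sum_add_distrib]

lemma norm_trailing_le (k : Fin n) : ‖trailing fl C k‖ ≤ ‖compL fl C‖ * ‖compU fl C‖ := by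
  have : trailing fl C k
      = (Matrix.of fun i m => if k ≤ m then compL fl C i m else 0) * compU fl C := by
    ext i j
    simp only [trailing, Matrix.of_apply, Matrix.mul_apply, ite_mul, zero_mul]
    rw [← Finset.sum_filter]
    congr 1
    ext m; simp
  rw [this]
  refine (Matrix.frobenius_norm_mul _ _).trans ?_
  gcongr
  refine frobenius_norm_mono fun i m => ?_
  rw [Matrix.of_apply]
  split_ifs <;> simp

lemma norm_hat_eq_div_mul {A Â : Matrix (Fin n) (Fin n) ℂ} (h : ∀ i j, A i j = 0 → Â i j = 0) :
    ‖Â‖ = ‖Â‖ / ‖A‖ * ‖A‖ := by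
  rcases eq_or_ne ‖A‖ 0 with hA | hA
  · have hA0 : A = 0 := norm_eq_zero.mp hA
    have : Â = 0 := by ext i j; exact h i j (by rw [hA0]; rfl)
    rw [this, norm_zero, zero_div, zero_mul]
  · rw [div_mul_cancel₀ _ hA]

lemma g₂_nonneg : 0 ≤ g₂ fl C := Real.iSup_nonneg fun _ => by positivity

lemma g₁_nonneg {c₇ c₈ c₉ : ℝ} (h₇ : 0 ≤ c₇) (h₈ : 0 ≤ c₈) (h₉ : 0 ≤ c₉) :
    0 ≤ g₁ c₇ c₈ c₉ fl C := by
  unfold g₁; positivity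

lemma norm_hatR_le (k : Fin n) (hk : 0 < (k : ℕ)) :
    ‖hatR fl C k‖ ≤ g₂ fl C * (‖compL fl C‖ * ‖compU fl C‖) := by
  rw [norm_hat_eq_div_mul (A := trailing fl C k) (Â := hatR fl C k)
    (fun i j h => by rw [hatR, Matrix.of_apply, h, mul_zero])]
  have : ‖hatR fl C k‖ / ‖trailing fl C k‖ ≤ g₂ fl C :=
    le_ciSup (f := fun k : {k : Fin n // 0 < (k : ℕ)} => ‖hatR fl C k‖ / ‖trailing fl C k‖)
      (Set.finite_range _).bddAbove ⟨k, hk⟩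
  have := norm_trailing_le (fl := fl) (C := C) k
  have := g₂_nonneg (fl := fl) (C := C)
  gcongr

/-- The backward error bound for Cauchy-type matrices. -/
lemma Admissible.norm_backwardError_le (h : Admissible fl C) {R : Matrix (Fin n) (Fin n) ℂ}
    (hR : C.Generates R) :
    ‖backwardError fl C R‖ ≤ ε * (320 * (C.bMax / C.bMin) * g₁ (1 / 2) (1 / 2) (1 / 2) fl C
      + 160 * n * g₂ fl C) * ‖compL fl C‖ * ‖compU fl C‖ := by
  have he := fl.eps_nonneg
  rcases Nat.eq_zero_or_pos n with rfl | hn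
  · have h0 : backwardError fl C R = 0 := Subsingleton.elim _ _
    have h1 : compL fl C = 0 := Subsingleton.elim _ _
    simp [h0, h1]
  have : NeZero n := ⟨hn.ne'⟩
  have hρ0 : 0 ≤ C.bMax / C.bMin := bRatio_nonneg
  have hL : ‖hatL fl C‖ = ‖hatL fl C‖ / ‖compL fl C‖ * ‖compL fl C‖ :=
    norm_hat_eq_div_mul fun i j h => by rw [hatL, Matrix.of_apply, h, mul_zero]
  have hU : ‖hatU fl C‖ = ‖hatU fl C‖ / ‖compU fl C‖ * ‖compU fl C‖ :=
    norm_hat_eq_div_mul fun i j h => by rw [hatU, Matrix.of_apply, h, zero_mul]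
  have h1 : ‖backwardError fl C R‖ ≤ _ := frobenius_norm_mono fun i j =>
    (h.norm_backwardError_apply_le hR i j).trans (Real.le_norm_self _)
  rw [frobenius_norm_const_mul, abs_of_nonneg (by positivity)] at h1
  have hsum : ‖∑ m ∈ Finset.univ.filter (fun m : Fin n => 0 < (m : ℕ)), modulus (hatR fl C m)‖
      ≤ n * (g₂ fl C * (‖compL fl C‖ * ‖compU fl C‖)) := by
    refine (norm_sum_le _ _).trans ?_
    refine (Finset.sum_le_sum (g := fun _ => g₂ fl C * (‖compL fl C‖ * ‖compU fl C‖))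
      fun m hm => ?_).trans ?_
    · rw [norm_modulus]
      exact norm_hatR_le m (Finset.mem_filter.mp hm).2
    · rw [Finset.sum_const, nsmul_eq_mul]
      have := g₂_nonneg (fl := fl) (C := C)
      gcongr
      exact (Finset.card_le_univ _).trans_eq (Fintype.card_fin n)
  have hprod : ‖modulus (hatL fl C) * modulus (compU fl C)
        + modulus (compL fl C) * modulus (hatU fl C)
        + modulus (compL fl C) * (modulus (Matrix.diagonal fun k => V fl C k k k)
          * modulus (compU fl C))‖
      ≤ ‖hatL fl C‖ * ‖compU fl C‖ + ‖compL fl C‖ * ‖hatU fl C‖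
        + ‖compL fl C‖ * (‖(Matrix.diagonal fun k => V fl C k k k : Matrix (Fin n) (Fin n) ℂ)‖
          * ‖compU fl C‖) := by
    simp only [← norm_modulus]
    refine norm_add₃_le.trans ?_
    gcongr
    · exact Matrix.frobenius_norm_mul _ _
    · exact Matrix.frobenius_norm_mul _ _
    · refine (Matrix.frobenius_norm_mul _ _).trans ?_
      gcongr
      exact Matrix.frobenius_norm_mul _ _
  refine h1.trans ?_
  refine (mul_le_mul_of_nonneg_left (norm_add_le _ _) (by positivity)).trans ?_
  rw [frobenius_norm_const_mul, abs_of_nonneg hρ0]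
  refine (mul_le_mul_of_nonneg_left (add_le_add (mul_le_mul_of_nonneg_left hprod hρ0) hsum)
    (by positivity)).trans_eq ?_
  rw [g₁]
  generalize ‖hatL fl C‖ / ‖compL fl C‖ = x at hL ⊢
  generalize ‖hatU fl C‖ / ‖compU fl C‖ = y at hU ⊢
  rw [hL, hU]
  ring

end Accumulation

end GKO

/-! ### The Cauchy-type matrix of a Toeplitz matrix -/

namespace GKO

section ToeplitzCauchy

variable {n : ℕ}

lemma toeplitzData_t_eq_pow (n : ℕ) (a : ℤ → ℂ) (k : Fin n) :
    (toeplitzData n a).t k = Complex.exp (2 * Real.pi * Complex.I / n) ^ (k : ℕ) := by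
  rw [← Complex.exp_nat_mul]
  simp only [toeplitzData]
  congr 1
  ring

lemma toeplitzData_s_eq_mul_t (n : ℕ) (a : ℤ → ℂ) (k : Fin n) :
    (toeplitzData n a).s k
      = Complex.exp (Real.pi * Complex.I / n) * (toeplitzData n a).t k := by
  simp only [toeplitzData]
  rw [← Complex.exp_add]
  congr 1
  ring

lemma exp_pi_mul_I_div_pow (n : ℕ) [NeZero n] :
    Complex.exp (Real.pi * Complex.I / n) ^ n = -1 := by
  have hn : (n : ℂ) ≠ 0 := Nat.cast_ne_zero.mpr (NeZero.ne n)
  rw [← Complex.exp_nat_mul, mul_div_cancel₀ _ hn, Complex.exp_pi_mul_I]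

lemma exp_two_pi_mul_I_div_pow (n : ℕ) [NeZero n] :
    Complex.exp (2 * Real.pi * Complex.I / n) ^ n = 1 :=
  (Complex.isPrimitiveRoot_exp n (NeZero.ne n)).pow_eq_one

lemma pow_val_add_one [NeZero n] {ω : ℂ} (h : ω ^ n = 1) (j : Fin n) :
    ω ^ ((j + 1 : Fin n) : ℕ) = ω * ω ^ (j : ℕ) := by
  rw [Fin.val_add, Fin.val_one', Nat.add_mod_mod, ← pow_succ']
  conv_rhs => rw [← Nat.div_add_mod ((j : ℕ) + 1) n, pow_add, pow_mul, h, one_pow, one_mul]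

lemma toeplitzData_t_injective (n : ℕ) [NeZero n] (a : ℤ → ℂ) :
    Function.Injective (toeplitzData n a).t := by
  intro i j h
  rw [toeplitzData_t_eq_pow, toeplitzData_t_eq_pow] at h
  exact Fin.ext ((Complex.isPrimitiveRoot_exp n (NeZero.ne n)).pow_inj i.2 j.2 h)

lemma range_toeplitzData_t (n : ℕ) [NeZero n] (a : ℤ → ℂ) :
    Set.range (toeplitzData n a).t = {z : ℂ | z ^ n = 1} := by
  ext z
  constructor
  · rintro ⟨k, rfl⟩
    rw [Set.mem_ofPred_eq, toeplitzData_t_eq_pow, pow_right_comm,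
      exp_two_pi_mul_I_div_pow, one_pow]
  · intro hz
    obtain ⟨k, hk, rfl⟩ :=
      (Complex.isPrimitiveRoot_exp n (NeZero.ne n)).eq_pow_of_pow_eq_one hz
    exact ⟨⟨k, hk⟩, toeplitzData_t_eq_pow n a _⟩

lemma toeplitzData_s_injective (n : ℕ) [NeZero n] (a : ℤ → ℂ) :
    Function.Injective (toeplitzData n a).s := by
  intro i j h
  rw [toeplitzData_s_eq_mul_t, toeplitzData_s_eq_mul_t] at h
  exact toeplitzData_t_injective n a (mul_left_cancel₀ (Complex.exp_ne_zero _) h)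

lemma range_toeplitzData_s (n : ℕ) [NeZero n] (a : ℤ → ℂ) :
    Set.range (toeplitzData n a).s = {z : ℂ | z ^ n = -1} := by
  have hmem := Set.ext_iff.mp (range_toeplitzData_t n a)
  ext z
  constructor
  · rintro ⟨k, rfl⟩
    have : (toeplitzData n a).t k ^ n = 1 := (hmem _).mp ⟨k, rfl⟩
    rw [Set.mem_ofPred_eq, toeplitzData_s_eq_mul_t, mul_pow, this, exp_pi_mul_I_div_pow, mul_one]
  · intro hz
    have hz' : z ^ n = -1 := hz
    obtain ⟨k, hk⟩ := (hmem (z / Complex.exp (Real.pi * Complex.I / n))).mpr (by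
      rw [Set.mem_ofPred_eq, div_pow, hz', exp_pi_mul_I_div_pow, div_self (by norm_num)])
    exact ⟨k, by rw [toeplitzData_s_eq_mul_t, hk, mul_div_cancel₀ _ (Complex.exp_ne_zero _)]⟩

lemma toeplitzData_t_add_one (n : ℕ) [NeZero n] (a : ℤ → ℂ) (j : Fin n) :
    (toeplitzData n a).t (j + 1)
      = Complex.exp (Real.pi * Complex.I / n) * (toeplitzData n a).s j := by
  rw [toeplitzData_s_eq_mul_t, ← mul_assoc, ← Complex.exp_add, toeplitzData_t_eq_pow,
    toeplitzData_t_eq_pow, pow_val_add_one (exp_two_pi_mul_I_div_pow n)]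
  congr 2
  ring

lemma toeplitzData_t_ne_s (n : ℕ) [NeZero n] (a : ℤ → ℂ) (i j : Fin n) :
    (toeplitzData n a).t i ≠ (toeplitzData n a).s j := by
  intro h
  have h1 : (toeplitzData n a).t i ^ n = 1 :=
    (Set.ext_iff.mp (range_toeplitzData_t n a) _).mp ⟨i, rfl⟩
  have h2 : (toeplitzData n a).s j ^ n = -1 :=
    (Set.ext_iff.mp (range_toeplitzData_s n a) _).mp ⟨j, rfl⟩
  rw [h, h2] at h1
  norm_num at h1

/-- The `θ`-circulant shift: ones below the diagonal and `θ` in the upper right corner. -/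
def shift (n : ℕ) [NeZero n] (θ : ℂ) : Matrix (Fin n) (Fin n) ℂ :=
  Matrix.of fun i j => if i = j + 1 then (if i = 0 then θ else 1) else 0

lemma mul_shift_apply [NeZero n] (θ : ℂ) (A : Matrix (Fin n) (Fin n) ℂ) (i j : Fin n) :
    (A * shift n θ) i j = A i (j + 1) * (if j + 1 = 0 then θ else 1) := by
  simp [Matrix.mul_apply, shift]

lemma shift_mul_apply [NeZero n] (θ : ℂ) (A : Matrix (Fin n) (Fin n) ℂ) (i j : Fin n) :
    (shift n θ * A) i j = (if i = 0 then θ else 1) * A (i - 1) j := by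
  simp [Matrix.mul_apply, shift, ← sub_eq_iff_eq_add]

lemma dft_apply (n : ℕ) (k j : Fin n) :
    dft n k j = 1 / (Real.sqrt n : ℂ)
      * (Complex.exp (2 * Real.pi * Complex.I / n) ^ (k : ℕ)) ^ (j : ℕ) := by
  rw [dft, Matrix.of_apply, ← Complex.exp_nat_mul, ← Complex.exp_nat_mul]
  congr 2
  ring

/-- The Fourier matrix diagonalizes the circulant shift. -/
lemma diagonal_t_mul_dft (n : ℕ) [NeZero n] (a : ℤ → ℂ) :
    Matrix.diagonal (toeplitzData n a).t * dft n = dft n * shift n 1 := by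
  ext k j
  rw [Matrix.diagonal_mul, mul_shift_apply, ite_self, mul_one, toeplitzData_t_eq_pow, dft_apply,
    dft_apply, pow_val_add_one]
  · ring
  · rw [pow_right_comm, exp_two_pi_mul_I_div_pow, one_pow]

lemma inv_matD (n : ℕ) : (matD n)⁻¹ = (matD n)ᴴ := by
  refine Matrix.inv_eq_right_inv ?_
  rw [matD, Matrix.diagonal_conjTranspose, Matrix.diagonal_mul_diagonal, ← Matrix.diagonal_one]
  congr 1
  ext k
  rw [Pi.star_apply, Complex.star_def, ← Complex.exp_conj, ← Complex.exp_add]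
  simp [neg_div]

lemma add_one_eq_zero_iff [NeZero n] {j : Fin n} : j + 1 = 0 ↔ (j : ℕ) + 1 = n := by
  rw [← Fin.val_eq_zero_iff, Fin.val_add, Fin.val_one', Nat.add_mod_mod]
  refine ⟨fun h => ?_, fun h => by rw [h, Nat.mod_self]⟩
  exact le_antisymm j.2 (Nat.le_of_dvd (Nat.succ_pos _) (Nat.dvd_of_mod_eq_zero h))

lemma val_add_one_of_ne [NeZero n] {j : Fin n} (h : (j : ℕ) + 1 ≠ n) :
    ((j + 1 : Fin n) : ℕ) = j + 1 := by
  rw [Fin.val_add, Fin.val_one', Nat.add_mod_mod, Nat.mod_eq_of_lt (by have := j.2; omega)]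

lemma dft_mul_matD_apply (n : ℕ) (k j : Fin n) :
    (dft n * matD n) k j = 1 / (Real.sqrt n : ℂ) * Complex.exp
      (Real.pi * Complex.I * (2 * (k : ℕ) + 1) / n) ^ (j : ℕ) := by
  rw [matD, Matrix.mul_diagonal, dft, Matrix.of_apply, mul_assoc, ← Complex.exp_add,
    ← Complex.exp_nat_mul]
  congr 2
  ring

lemma s_mul_star_s (n : ℕ) (a : ℤ → ℂ) (k : Fin n) :
    (toeplitzData n a).s k * star ((toeplitzData n a).s k) = 1 := by
  simp only [toeplitzData]
  rw [Complex.star_def, ← Complex.exp_conj, ← Complex.exp_add]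
  simp [neg_div, map_ofNat]

/-- `F D` diagonalizes the skew-circulant shift; here for the adjoint `D⁻¹ F*`. -/
lemma dft_mul_matD_conjTranspose_mul_diagonal_s (n : ℕ) [NeZero n] (a : ℤ → ℂ) :
    (dft n * matD n)ᴴ * Matrix.diagonal (toeplitzData n a).s
      = shift n (-1) * (dft n * matD n)ᴴ := by
  ext j k
  obtain ⟨j, rfl⟩ : ∃ j', j = j' + 1 := ⟨j - 1, by simp⟩
  rw [Matrix.mul_diagonal, shift_mul_apply, add_sub_cancel_right, Matrix.conjTranspose_apply,
    Matrix.conjTranspose_apply, dft_mul_matD_apply, dft_mul_matD_apply]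
  change star (_ * (toeplitzData n a).s k ^ _) * _ = _ * star (_ * (toeplitzData n a).s k ^ _)
  have hs := s_mul_star_s n a k
  have hsn : (toeplitzData n a).s k ^ n = -1 :=
    (Set.ext_iff.mp (range_toeplitzData_s n a) _).mp ⟨k, rfl⟩
  generalize (toeplitzData n a).s k = s at *
  have hpow : star s ^ ((j : ℕ) + 1) * s = star s ^ (j : ℕ) := by
    rw [pow_succ, mul_assoc, mul_comm (star s), hs, mul_one]
  simp only [star_mul', star_pow]
  by_cases hj : (j : ℕ) + 1 = n
  · have h0 : j + 1 = 0 := add_one_eq_zero_iff.mpr hj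
    have hneg : star s ^ ((j : ℕ) + 1) = -1 := by rw [hj, ← star_pow, hsn]; simp
    rw [hneg] at hpow
    rw [h0, if_pos rfl, Fin.val_zero, pow_zero, ← hpow]
    ring
  · rw [if_neg (fun h => hj (add_one_eq_zero_iff.mp h)), val_add_one_of_ne hj, one_mul,
      mul_assoc, hpow]

/-- The displacement of a Toeplitz matrix under circulant shifts has rank at most two. -/
lemma shift_mul_toeplitz_sub (n : ℕ) [NeZero n] (a : ℤ → ℂ) :
    shift n 1 * toeplitz n a - toeplitz n a * shift n (-1) = toeplitzΩ n a * toeplitzΓ n a := by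
  ext i j
  obtain ⟨i, rfl⟩ : ∃ i', i = i' + 1 := ⟨i - 1, by simp⟩
  rw [Matrix.sub_apply, shift_mul_apply, mul_shift_apply, add_sub_cancel_right, ite_self, one_mul,
    Matrix.mul_apply, Fin.sum_univ_two]
  simp only [toeplitz, toeplitzΩ, toeplitzΓ, Matrix.of_apply, Fin.val_eq_zero_iff]
  by_cases hi : (i : ℕ) + 1 = n <;> by_cases hj : (j : ℕ) + 1 = n
  · have hij : ((i : ℕ) : ℤ) - ((j : ℕ) : ℤ) = 0 := by omega
    simp [add_one_eq_zero_iff.mpr hi, add_one_eq_zero_iff.mpr hj, hj, hij]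
  · have hij : ((i : ℕ) : ℤ) - ((j : ℕ) : ℤ) = n - 1 - j := by omega
    have hij' : (0 : ℤ) - ((j + 1 : ℕ) : ℤ) = -1 - j := by push_cast; ring
    have h1 : j + 1 ≠ 0 := fun h => hj (add_one_eq_zero_iff.mp h)
    simp [add_one_eq_zero_iff.mpr hi, h1, hj, hij, val_add_one_of_ne hj, ← hij']
  · have h1 : i + 1 ≠ 0 := fun h => hi (add_one_eq_zero_iff.mp h)
    have hij : ((i : ℕ) : ℤ) - ((j : ℕ) : ℤ) = i + 1 - n := by omega
    simp [add_one_eq_zero_iff.mpr hj, h1, hj, hij, val_add_one_of_ne hi]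
  · have h1 : i + 1 ≠ 0 := fun h => hi (add_one_eq_zero_iff.mp h)
    have h2 : j + 1 ≠ 0 := fun h => hj (add_one_eq_zero_iff.mp h)
    simp [h1, h2, hj, val_add_one_of_ne hi, val_add_one_of_ne hj]

lemma toeplitzData_generates (n : ℕ) [NeZero n] (a : ℤ → ℂ) :
    (toeplitzData n a).Generates (toeplitzR n a) := by
  refine ⟨toeplitzData_t_ne_s n a, ?_⟩
  have hR : toeplitzR n a = dft n * toeplitz n a * (dft n * matD n)ᴴ := by
    rw [toeplitzR, inv_matD, Matrix.conjTranspose_mul, Matrix.mul_assoc (dft n * toeplitz n a)]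
  have hΨ : (toeplitzData n a).Ψ = toeplitzΓ n a * (dft n * matD n)ᴴ := by
    simp only [toeplitzData, Matrix.conjTranspose_mul, Matrix.conjTranspose_conjTranspose]
  have hΦ : (toeplitzData n a).Φ = dft n * toeplitzΩ n a := rfl
  rw [hR, hΨ, hΦ, Matrix.mul_assoc (dft n * toeplitz n a),
    dft_mul_matD_conjTranspose_mul_diagonal_s, ← Matrix.mul_assoc, ← Matrix.mul_assoc,
    diagonal_t_mul_dft, Matrix.mul_assoc (dft n) (toeplitzΩ n a),
    ← Matrix.mul_assoc (toeplitzΩ n a),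
    ← shift_mul_toeplitz_sub]
  noncomm_ring

end ToeplitzCauchy

end GKO

/-! ### Distances between the roots of `1` and of `-1` -/

namespace GKO

section NodeDistances

variable {n : ℕ}

lemma norm_toeplitzData_t (n : ℕ) (a : ℤ → ℂ) (k : Fin n) : ‖(toeplitzData n a).t k‖ = 1 := by
  have : (toeplitzData n a).t k
      = Complex.exp ((2 * Real.pi * (k : ℕ) / n : ℝ) * Complex.I) := by
    simp only [toeplitzData]
    congr 1
    push_cast
    ring
  rw [this, Complex.norm_exp_ofReal_mul_I]

lemma norm_t_sub_s (n : ℕ) (a : ℤ → ℂ) (i j : Fin n) :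
    ‖(toeplitzData n a).t i - (toeplitzData n a).s j‖
      = 2 * |Real.sin (Real.pi * ((2 * ((j : ℤ) - (i : ℤ)) + 1 : ℤ) : ℝ) / (2 * n))| := by
  set x : ℝ := Real.pi * ((2 * ((j : ℤ) - (i : ℤ)) + 1 : ℤ) : ℝ) / n with hx
  have hs : (toeplitzData n a).s j = (toeplitzData n a).t i * Complex.exp (Complex.I * x) := by
    simp only [toeplitzData]
    rw [← Complex.exp_add, hx]
    congr 1
    push_cast
    ring
  rw [hs, show (toeplitzData n a).t i - (toeplitzData n a).t i * Complex.exp (Complex.I * x)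
    = -((toeplitzData n a).t i * (Complex.exp (Complex.I * x) - 1)) by ring, norm_neg, norm_mul,
    norm_toeplitzData_t, one_mul, Complex.norm_exp_I_mul_ofReal_sub_one, norm_mul,
    Real.norm_eq_abs, Real.norm_eq_abs, abs_two]
  congr 3
  rw [hx]
  ring

/-- All distances between nodes are chords of angle `π m / n` with `m ≤ n` odd. -/
lemma exists_norm_t_sub_s_eq (n : ℕ) [NeZero n] (a : ℤ → ℂ) (i j : Fin n) :
    ∃ m : ℕ, Odd m ∧ m ≤ n ∧ ‖(toeplitzData n a).t i - (toeplitzData n a).s j‖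
      = 2 * Real.sin (Real.pi * m / (2 * n)) := by
  have hn : (0 : ℝ) < n := Nat.cast_pos.mpr (NeZero.pos n)
  set N : ℤ := 2 * ((j : ℤ) - (i : ℤ)) + 1 with hN
  have hodd : Odd N.natAbs := Int.natAbs_odd.mpr ⟨_, hN⟩
  have hlt : N.natAbs < 2 * n := by have := i.2; have := j.2; omega
  have hlt' : (N.natAbs : ℝ) < 2 * n := by exact_mod_cast hlt
  have hnorm : ‖(toeplitzData n a).t i - (toeplitzData n a).s j‖
      = 2 * Real.sin (Real.pi * N.natAbs / (2 * n)) := by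
    have hpos : 0 ≤ Real.sin (Real.pi * N.natAbs / (2 * n)) := by
      refine Real.sin_nonneg_of_nonneg_of_le_pi (by positivity) ?_
      rw [div_le_iff₀ (by positivity)]
      gcongr
    rw [norm_t_sub_s, ← hN, ← abs_of_nonneg hpos, Nat.cast_natAbs, Int.cast_abs]
    rcases abs_choice (N : ℝ) with h | h
    · rw [h]
    · rw [h, mul_neg, neg_div, Real.sin_neg, abs_neg]
  -- chords of the angles `θ` and `2 π - θ` agree, and `2 n - m` is odd with `m`
  rcases le_or_gt N.natAbs n with h | h
  · exact ⟨_, hodd, h, hnorm⟩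
  · refine ⟨2 * n - N.natAbs, Nat.Even.sub_odd hlt.le (even_two_mul n) hodd, by omega, ?_⟩
    rw [hnorm, ← Real.sin_pi_sub, Nat.cast_sub hlt.le]
    congr 2
    push_cast
    field_simp

lemma sin_pi_div_two_mul_pos (n : ℕ) [NeZero n] : 0 < Real.sin (Real.pi / (2 * n)) := by
  have hn : (1 : ℝ) ≤ n := by exact_mod_cast NeZero.one_le
  refine Real.sin_pos_of_pos_of_lt_pi (by positivity) ?_
  exact div_lt_self Real.pi_pos (by linarith)

lemma sin_le_sin_of_le {m m' : ℝ} [NeZero n] (h0 : 0 ≤ m) (h : m ≤ m') (h' : m' ≤ n) :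
    Real.sin (Real.pi * m / (2 * n)) ≤ Real.sin (Real.pi * m' / (2 * n)) := by
  have hn : (0 : ℝ) < n := Nat.cast_pos.mpr (NeZero.pos n)
  refine Real.sin_le_sin_of_le_of_le_pi_div_two ?_ ?_ (by gcongr)
  · have : 0 ≤ Real.pi * m / (2 * n) := by positivity
    linarith [Real.pi_pos]
  · rw [div_le_div_iff₀ (by positivity) two_pos]
    nlinarith [Real.pi_pos]

lemma two_mul_sin_le_norm_t_sub_s (n : ℕ) [NeZero n] (a : ℤ → ℂ) (i j : Fin n) :
    2 * Real.sin (Real.pi / (2 * n)) ≤ ‖(toeplitzData n a).t i - (toeplitzData n a).s j‖ := by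
  obtain ⟨m, hm, hmn, h⟩ := exists_norm_t_sub_s_eq n a i j
  rw [h]
  have := sin_le_sin_of_le (n := n) (m := 1) (m' := m) zero_le_one
    (by exact_mod_cast hm.pos) (by exact_mod_cast hmn)
  rw [mul_one] at this
  gcongr

lemma bMax_toeplitzData_le (n : ℕ) [NeZero n] (a : ℤ → ℂ) :
    (toeplitzData n a).bMax ≤ 1 / (2 * Real.sin (Real.pi / (2 * n))) := by
  have := sin_pi_div_two_mul_pos n
  refine ciSup_le fun p => ?_
  rw [norm_B_apply]
  have := two_mul_sin_le_norm_t_sub_s n a p.1 p.2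
  gcongr

lemma bRatio_toeplitzData_lt (n : ℕ) [NeZero n] (a : ℤ → ℂ) (he : Even n) :
    (toeplitzData n a).bMax / (toeplitzData n a).bMin < 2 * n / Real.pi := by
  have hn2 : 2 ≤ n := by have := NeZero.pos n; obtain ⟨c, rfl⟩ := he; omega
  have hn : (2 : ℝ) ≤ n := by exact_mod_cast hn2
  set x := Real.pi / (2 * n) with hx
  have hx0 : 0 < x := by positivity
  have hx1 : x < Real.pi / 2 := by
    rw [hx]
    gcongr
    linarith
  have hsin : 0 < Real.sin x := sin_pi_div_two_mul_pos n
  have hcos : 0 < Real.cos x := Real.cos_pos_of_mem_Ioo ⟨by linarith, hx1⟩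
  have hmin : 1 / (2 * Real.cos x) ≤ (toeplitzData n a).bMin := by
    refine le_ciInf fun p => ?_
    rw [norm_B_apply]
    have hpos : 0 < ‖(toeplitzData n a).t p.1 - (toeplitzData n a).s p.2‖ :=
      norm_pos_iff.mpr (sub_ne_zero.mpr (toeplitzData_t_ne_s n a _ _))
    refine one_div_le_one_div_of_le hpos ?_
    obtain ⟨m, hm, hmn, h⟩ := exists_norm_t_sub_s_eq n a p.1 p.2
    -- `m` is odd and `n` is even, so the diameter `m = n` does not occur
    have hne : m ≠ n := fun h => Nat.not_even_iff_odd.mpr hm (h ▸ he)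
    have hm1 : m + 1 ≤ n := by omega
    have hm1' : (m : ℝ) ≤ n - 1 := by
      rw [le_sub_iff_add_le]; exact_mod_cast hm1
    have hle := sin_le_sin_of_le (n := n) (m := m) (m' := n - 1) (Nat.cast_nonneg m) hm1'
      (by linarith)
    have hc : Real.pi * (n - 1) / (2 * n) = Real.pi / 2 - x := by
      rw [hx]; field_simp
    rw [hc, Real.sin_pi_div_two_sub] at hle
    rw [h]
    gcongr
  have htan := Real.lt_tan hx0 hx1
  rw [Real.tan_eq_sin_div_cos, lt_div_iff₀ hcos] at htan
  calc (toeplitzData n a).bMax / (toeplitzData n a).bMin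
      ≤ 1 / (2 * Real.sin x) / (1 / (2 * Real.cos x)) := by
        have := bMax_toeplitzData_le n a
        gcongr
    _ = Real.cos x / Real.sin x := by field_simp
    _ < 1 / x := by
        rw [div_lt_div_iff₀ hsin hx0]
        linarith
    _ = 2 * n / Real.pi := by rw [hx]; field_simp

lemma bRatio_toeplitzData_eq (n : ℕ) [NeZero n] (a : ℤ → ℂ) (ho : Odd n) :
    (toeplitzData n a).bMax / (toeplitzData n a).bMin = 1 / Real.sin (Real.pi / (2 * n)) := by
  have hsin := sin_pi_div_two_mul_pos n
  have hn : (0 : ℝ) < n := Nat.cast_pos.mpr (NeZero.pos n)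
  have hmax : (toeplitzData n a).bMax = 1 / (2 * Real.sin (Real.pi / (2 * n))) := by
    refine le_antisymm (bMax_toeplitzData_le n a) ?_
    refine le_trans (le_of_eq ?_) (le_bMax (C := toeplitzData n a) 0 0)
    rw [norm_t_sub_s]
    simp [abs_of_pos hsin]
  have hmin : (toeplitzData n a).bMin = 1 / 2 := by
    refine le_antisymm ?_ (le_ciInf fun p => ?_)
    -- for odd `n = 2 c + 1` the nodes `t_0 = 1` and `s_c = -1` are antipodal
    · obtain ⟨c, hc⟩ := ho
      have hcn : c < n := by omega
      refine (bMin_le (C := toeplitzData n a) 0 ⟨c, hcn⟩).trans_eq ?_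
      have hN : (((2 * ((c : ℤ) - ((0 : Fin n) : ℕ)) + 1 : ℤ)) : ℝ) = n := by
        have hc' : (n : ℝ) = 2 * c + 1 := by exact_mod_cast hc
        rw [hc']; simp
      rw [norm_t_sub_s, hN, show Real.pi * n / (2 * n) = Real.pi / 2 by field_simp]
      simp
    · rw [norm_B_apply]
      have hpos : 0 < ‖(toeplitzData n a).t p.1 - (toeplitzData n a).s p.2‖ :=
        norm_pos_iff.mpr (sub_ne_zero.mpr (toeplitzData_t_ne_s n a _ _))
      refine one_div_le_one_div_of_le hpos ?_
      obtain ⟨m, -, -, h⟩ := exists_norm_t_sub_s_eq n a p.1 p.2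
      rw [h]
      linarith [Real.sin_le_one (Real.pi * m / (2 * n))]
  rw [hmax, hmin]
  field_simp

lemma bRatio_toeplitzData_le (n : ℕ) [NeZero n] (a : ℤ → ℂ) :
    (toeplitzData n a).bMax / (toeplitzData n a).bMin ≤ n := by
  have hn : (1 : ℝ) ≤ n := by exact_mod_cast NeZero.one_le
  rcases Nat.even_or_odd n with he | ho
  · refine (bRatio_toeplitzData_lt n a he).le.trans ?_
    rw [div_le_iff₀ Real.pi_pos]
    nlinarith [Real.two_le_pi]
  · rw [bRatio_toeplitzData_eq n a ho]
    have h := Real.mul_le_sin (x := Real.pi / (2 * n)) (by positivity) (by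
      gcongr
      linarith)
    rw [show 2 / Real.pi * (Real.pi / (2 * n)) = 1 / (n : ℝ) by field_simp] at h
    rw [div_le_iff₀ (sin_pi_div_two_mul_pos n)]
    rw [div_le_iff₀ (by positivity)] at h
    linarith

end NodeDistances

/-! ### Row permutations and the bound for Toeplitz matrices -/

section Permutation

variable {n : ℕ}

lemma generates_permRows {C : CauchyData n} {R : Matrix (Fin n) (Fin n) ℂ} (h : C.Generates R)
    (σ : Equiv.Perm (Fin n)) : (C.permRows σ).Generates (R.submatrix σ id) := by
  refine ⟨fun i j => h.1 _ _, ?_⟩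
  ext i j
  have := sub_mul_apply_of_generates h (σ i) j
  rw [Matrix.sub_apply, Matrix.diagonal_mul, Matrix.mul_diagonal, Matrix.submatrix_apply, id,
    mul_comm (R _ _), ← sub_mul]
  exact this

lemma bMax_permRows (C : CauchyData n) (σ : Equiv.Perm (Fin n)) :
    (C.permRows σ).bMax = C.bMax :=
  (σ.prodCongr (Equiv.refl _)).iSup_comp (g := fun p : Fin n × Fin n => ‖C.B p.1 p.2‖)

lemma bMin_permRows (C : CauchyData n) (σ : Equiv.Perm (Fin n)) :
    (C.permRows σ).bMin = C.bMin :=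
  (σ.prodCongr (Equiv.refl _)).iInf_comp (g := fun p : Fin n × Fin n => ‖C.B p.1 p.2‖)

/-- The backward error bound for matrices that come from Toeplitz matrices. -/
lemma Admissible.norm_backwardError_toeplitz_le [NeZero n] {ε : ℝ} {fl : FloatArith ε}
    {a : ℤ → ℂ} {σ : Equiv.Perm (Fin n)} (h : Admissible fl ((toeplitzData n a).permRows σ)) :
    ‖backwardError fl ((toeplitzData n a).permRows σ) ((toeplitzR n a).submatrix σ id)‖
      ≤ ε * 480 * max (g₁ (1 / 2) (1 / 2) (1 / 2) fl ((toeplitzData n a).permRows σ))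
        (g₂ fl ((toeplitzData n a).permRows σ)) * n
        * ‖compL fl ((toeplitzData n a).permRows σ)‖
        * ‖compU fl ((toeplitzData n a).permRows σ)‖ := by
  have he := fl.eps_nonneg
  refine (h.norm_backwardError_le (generates_permRows (toeplitzData_generates n a) σ)).trans ?_
  rw [bMax_permRows, bMin_permRows]
  set C := (toeplitzData n a).permRows σ
  have hg1 : 0 ≤ g₁ (1 / 2) (1 / 2) (1 / 2) fl C :=
    g₁_nonneg (by norm_num) (by norm_num) (by norm_num)
  set G := max (g₁ (1 / 2) (1 / 2) (1 / 2) fl C) (g₂ fl C)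
  have h1 : g₁ (1 / 2) (1 / 2) (1 / 2) fl C ≤ G := le_max_left _ _
  have h2 : g₂ fl C ≤ G := le_max_right _ _
  have hr := bRatio_toeplitzData_le n a
  calc _ ≤ ε * (320 * n * G + 160 * n * G) * ‖compL fl C‖ * ‖compU fl C‖ := by gcongr
    _ = _ := by ring

end Permutation

end GKO

theorem mainTheorem2 :
    (∀ (n : ℕ) [NeZero n] (a : ℤ → ℂ),
      (GKO.toeplitzData n a).Generates (GKO.toeplitzR n a) ∧
      Function.Injective (GKO.toeplitzData n a).t ∧
      Set.range (GKO.toeplitzData n a).t = {z : ℂ | z ^ n = 1} ∧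
      Function.Injective (GKO.toeplitzData n a).s ∧
      Set.range (GKO.toeplitzData n a).s = {z : ℂ | z ^ n = -1} ∧
      (∀ j : Fin n,
        (GKO.toeplitzData n a).s j
          = Complex.exp (Real.pi * Complex.I / n) * (GKO.toeplitzData n a).t j ∧
        (GKO.toeplitzData n a).t (j + 1)
          = Complex.exp (Real.pi * Complex.I / n) * (GKO.toeplitzData n a).s j) ∧
      (Even n → (GKO.toeplitzData n a).bMax / (GKO.toeplitzData n a).bMin < 2 * n / Real.pi) ∧
      (Odd n → (GKO.toeplitzData n a).bMax / (GKO.toeplitzData n a).bMin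
          = 1 / Real.sin (Real.pi / (2 * n))) ∧
      (GKO.toeplitzData n a).bMax / (GKO.toeplitzData n a).bMin ≤ n) ∧
    ∃ c₅ c₆ c₇ c₈ c₉ η : ℝ,
      0 < c₅ ∧ 0 < c₆ ∧ (0 < c₇ ∧ c₇ < 1) ∧ (0 < c₈ ∧ c₈ < 1) ∧ (0 < c₉ ∧ c₉ < 1) ∧ 0 < η ∧
      (∀ (n : ℕ) (C₀ : GKO.CauchyData n) (R : Matrix (Fin n) (Fin n) ℂ), C₀.Generates R →
        ∀ (ε : ℝ) (fl : GKO.FloatArith ε) (σ : Equiv.Perm (Fin n)) (C : GKO.CauchyData n),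
          C = C₀.permRows σ →
          GKO.Pivoted fl C → GKO.VDefined fl C →
          ε ≤ η → (∀ k i j : Fin n, n * ε * ‖GKO.V fl C k i j‖ ≤ η) →
          ‖GKO.backwardError fl C (R.submatrix σ id)‖
            ≤ ε * (c₅ * (C.bMax / C.bMin) * GKO.g₁ c₇ c₈ c₉ fl C + c₆ * n * GKO.g₂ fl C)
                * ‖GKO.compL fl C‖ * ‖GKO.compU fl C‖) ∧
      (∀ (n : ℕ) [NeZero n] (a : ℤ → ℂ)
        (ε : ℝ) (fl : GKO.FloatArith ε) (σ : Equiv.Perm (Fin n)) (C : GKO.CauchyData n),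
          C = (GKO.toeplitzData n a).permRows σ →
          GKO.Pivoted fl C → GKO.VDefined fl C →
          ε ≤ η → (∀ k i j : Fin n, n * ε * ‖GKO.V fl C k i j‖ ≤ η) →
          ‖GKO.backwardError fl C ((GKO.toeplitzR n a).submatrix σ id)‖
            ≤ ε * max (2 * c₅ / Real.pi) c₆
                * max (GKO.g₁ c₇ c₈ c₉ fl C) (GKO.g₂ fl C) * n
                * ‖GKO.compL fl C‖ * ‖GKO.compU fl C‖) := by
  refine ⟨fun n _ a => ⟨GKO.toeplitzData_generates n a, GKO.toeplitzData_t_injective n a,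
    GKO.range_toeplitzData_t n a, GKO.toeplitzData_s_injective n a,
    GKO.range_toeplitzData_s n a,
    fun j => ⟨GKO.toeplitzData_s_eq_mul_t n a j, GKO.toeplitzData_t_add_one n a j⟩,
    GKO.bRatio_toeplitzData_lt n a, GKO.bRatio_toeplitzData_eq n a,
    GKO.bRatio_toeplitzData_le n a⟩, ?_⟩
  -- `c₅` is three times the constant of the general bound, so that `2 c₅ / π` dominates the sum
  -- of both constants: the Toeplitz bound has a maximum where the general one has a sum
  refine ⟨960, 160, 1 / 2, 1 / 2, 1 / 2, 1 / 1000, by norm_num, by norm_num, by norm_num,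
    by norm_num, by norm_num, by norm_num, ?_, ?_⟩
  · intro n C₀ R hR ε fl σ C hC hp hV hε hη
    have hR' : C.Generates (R.submatrix σ id) := hC ▸ GKO.generates_permRows hR σ
    have he := fl.eps_nonneg
    have hρ : 0 ≤ C.bMax / C.bMin := GKO.bRatio_nonneg
    have hg : 0 ≤ GKO.g₁ (1 / 2) (1 / 2) (1 / 2) fl C :=
      GKO.g₁_nonneg (by norm_num) (by norm_num) (by norm_num)
    have h : GKO.Admissible fl C := ⟨hR'.1, hp, hV, hε, hη⟩
    refine (h.norm_backwardError_le hR').trans ?_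
    gcongr
    norm_num
  · intro n _ a ε fl σ C hC hp hV hε hη
    subst hC
    have he := fl.eps_nonneg
    have hR' := GKO.generates_permRows (GKO.toeplitzData_generates n a) σ
    have h : GKO.Admissible fl ((GKO.toeplitzData n a).permRows σ) := ⟨hR'.1, hp, hV, hε, hη⟩
    have hg : 0 ≤ GKO.g₂ fl ((GKO.toeplitzData n a).permRows σ) := GKO.g₂_nonneg
    have hG := hg.trans
      (le_max_right (GKO.g₁ (1 / 2) (1 / 2) (1 / 2) fl ((GKO.toeplitzData n a).permRows σ)) _)
    refine h.norm_backwardError_toeplitz_le.trans ?_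
    gcongr
    refine le_trans ?_ (le_max_left _ _)
    rw [le_div_iff₀ Real.pi_pos]
    linarith [Real.pi_le_four]
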